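/- **Setting.** Let $N\in\mathbb N$ and $1<m<p<N$ with $$p-1\le m<p-1+\frac pN,\qquad p<\sigma<p^*:=\frac{Np}{N-p},\qquad\text{and}\qquad p\le 2\ \text{ or }\ m\le 2\ \text{ or }\ \sigma\le 2 .$$ Let $\Omega\subset\mathbb R^N$ be an open set (for instance a smooth domain) with bounded complement, and let $X_0(\Omega)=W^{1,p}_0(\Omega)\cap D^{1,m}_0(\Omega)$ be the completion of $C_c^\infty(\Omega)$ in the norm $\|u\|_{W^{1,p}(\Omega)}+\|Du\|_{L^m(\Omega)}$; its elements are extended by zero outside $\Omega$. Let $V$ be continuous and bounded on $\Omega$ with $\inf_\Omega V>0$ and $V(x)\to V_\infty\in\mathbb R$ as $|x|\to\infty$. Let $\nu>0$ and $C\in\mathbb R$. *Assumptions on $L$.* $L\in C^1(\mathbb R^N)$ is strictly convex and, for all $\xi$, $\nu|\xi|^p\le|L(\xi)|\le C|\xi|^p$ and $|L_\xi(\xi)|\le C|\xi|^{p-1}$. If $p\le2$, then $L_\xi\in C^1(\mathbb R^N\setminus\{0\})$ and $$\sup_{h\ne0,\ \xi}\frac{|L_\xi(\xi+h)-L_\xi(\xi)|}{|h|^{p-1}}<\infty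 .$$ If $p>2$, then $L\in C^2$ and $|L_{\xi\xi}(\xi)|\le C|\xi|^{p-2}$. *Assumptions on $M$.* $M\in C^1(\mathbb R\times\mathbb R^N)$, $M(s,\cdot)$ is strictly convex for each $s$, the derivatives $M_{ss}$ and $M_{s\xi}$ exist and are continuous on $\mathbb R\times\mathbb R^N$, and for all $(s,\xi)$ $$\nu|\xi|^m\le M(s,\xi)\le C|\xi|^m,\quad |M_s|\le C|\xi|^m,\quad |M_\xi|\le C|\xi|^{m-1},\quad |M_{ss}|\le C|\xi|^m,\quad |M_{s\xi}|\le C|\xi|^{m-1},\quad M_s(s,\xi)\,s\ge0 .$$ If $m\le2$, then $M_\xi\in C^1(\mathbb R\times(\mathbb R^N\setminus\{0\}))$ and $$\sup_{h\ne0,\ (s,\xi)}\frac{|M_\xi(s,\xi+h)-M_\xi(s,\xi)|}{|h|^{m-1}}<\infty .$$ If $m>2$, then $M\in C^2$ and $|M_{\xi\xi}|\le C|\xi|^{m-2}$. *Assumptions on $G$.* $G\in C^1(\mathbb R)$, $G(0)=0$ and $|G'(s)|\le C|s|^{\sigma-1}$. If $\sigma\le2$, then $G'\in C^1(\mathbb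 R\setminus\{0\})$ and $$\sup_{t\ne0,\ s}\frac{|G'(s+t)-G'(s)|}{|t|^{\sigma-1}}<\infty .$$ If $\sigma>2$, then $G\in C^2$ and $|G''(s)|\le C|s|^{\sigma-2}$. Put $j(s,\xi)=L(\xi)+M(s,\xi)-G(s)$ and $$\phi(u)=\int_\Omega j(u,Du)+\int_\Omega V\frac{|u|^p}p,\qquad \phi_\infty(u)=\int_{\mathbb R^N}j(u,Du)+\int_{\mathbb R^N}V_\infty\frac{|u|^p}p .$$ **Theorem 3.5.** Let $u_n,u\in X_0(\Omega)$ with $u_n\rightharpoonup u$ weakly in $X_0(\Omega)$, $u_n\to u$ and $Du_n\to Du$ a.e. in $\Omega$. Suppose there are $w_n\in X_0(\Omega)^*$ with $w_n\to0$ in $X_0(\Omega)^*$ and, for all $n$ and all $v\in X_0(\Omega)$, $$\int_\Omega j_\xi(u_n,Du_n)\cdot Dv+\int_\Omega j_s(u_n,Du_n)v+\int_\Omega V|u_n|^{p-2}u_nv=\langle w_n,v\rangle .$$ Then: 1. $\phi'(u)=0$ (Fréchet derivative on $X_0(\Omega)$). 2. There are $\hat\xi_n\in X_0(\Omega)^*$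 with $\hat\xi_n\to0$ in $X_0(\Omega)^*$ such that, for all $n$ and all $v\in X_0(\Omega)$, $$\begin{aligned}\langle\hat\xi_n,v\rangle={}&\int_\Omega j_s(u_n-u,Du_n-Du)v+\int_\Omega j_\xi(u_n-u,Du_n-Du)\cdot Dv\\&-\int_\Omega j_s(u_n,Du_n)v-\int_\Omega j_\xi(u_n,Du_n)\cdot Dv+\int_\Omega j_s(u,Du)v+\int_\Omega j_\xi(u,Du)\cdot Dv .\end{aligned}$$ 3. There are $\hat\zeta_n\in X_0(\Omega)^*$ with $\hat\zeta_n\to0$ in $X_0(\Omega)^*$ such that, for all $n$ and all $v\in X_0(\Omega)$, $$\int_\Omega j_\xi(u_n-u,Du_n-Du)\cdot Dv+\int_\Omega j_s(u_n-u,Du_n-Du)v+\int_\Omega V_\infty|u_n-u|^{p-2}(u_n-u)v=\langle\hat\zeta_n,v\rangle ,$$ and $\hat\zeta_n$ is the Fréchet derivative at $u_n-u$ of $\phi_\infty$ restricted to $X_0(\Omega)$; that is, $\phi_\infty'(u_n-u)\to0$ in $X_0(\Omega)^*$. -/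

import Mathlib

open MeasureTheory Filter Topology Set
open scoped ENNReal Distributions Gradient

namespace QuasilinearSplitting

noncomputable section

/-- Euclidean space of dimension `N`. -/
abbrev Euc (N : ℕ) : Type := EuclideanSpace ℝ (Fin N)

/-- Triples `(w, F, H)` in `L^p × L^p × L^m` over the whole space, with norm
`(‖w‖_p ^ p + ‖F‖_p ^ p) ^ (1 / p) + ‖H‖_m`. A function `w` of `W^{1,p} ∩ D^{1,m}` is represented by
`(w, Dw, Dw)`, and this norm is then `‖w‖_{W^{1,p}} + ‖Dw‖_{L^m}`. -/
abbrev Triple (N : ℕ) (p m : ℝ) [Fact (1 ≤ ENNReal.ofReal p)] [Fact (1 ≤ ENNReal.ofReal m)] :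
    Type :=
  WithLp 1
    (WithLp (ENNReal.ofReal p)
      (Lp ℝ (ENNReal.ofReal p) (volume : Measure (Euc N)) ×
        Lp (Euc N) (ENNReal.ofReal p) (volume : Measure (Euc N))) ×
      Lp (Euc N) (ENNReal.ofReal m) (volume : Measure (Euc N)))

section Space

variable {N : ℕ} {p m : ℝ} [Fact (1 ≤ ENNReal.ofReal p)] [Fact (1 ≤ ENNReal.ofReal m)]

/-- The function underlying a triple (a representative of its almost everywhere class). -/
def val (w : Triple N p m) : Euc N → ℝ := w.fst.fst

/-- The gradient carried by a triple (a representative of its almost everywhere class). -/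
def grad (w : Triple N p m) : Euc N → Euc N := w.fst.snd

/-- The triple `w` is `(f, Df, Df)`. -/
def Represents (w : Triple N p m) (f : Euc N → ℝ) : Prop :=
  (w.fst.fst : Euc N → ℝ) =ᵐ[volume] f ∧
    (w.fst.snd : Euc N → Euc N) =ᵐ[volume] ∇ f ∧
      (w.snd : Euc N → Euc N) =ᵐ[volume] ∇ f

theorem gradient_add_of_differentiable {f g : Euc N → ℝ} (hf : Differentiable ℝ f)
    (hg : Differentiable ℝ g) : ∇ (f + g) = ∇ f + ∇ g := by
  funext x
  simp [gradient, fderiv_add (hf x) (hg x)]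

theorem gradient_smul_of_differentiable {f : Euc N → ℝ} (c : ℝ) (hf : Differentiable ℝ f) :
    ∇ (c • f) = c • ∇ f := by
  funext x
  simp [gradient, fderiv_const_smul (hf x) c]

theorem TestFunction_differentiable {Ω : TopologicalSpace.Opens (Euc N)} (f : 𝓓(Ω, ℝ)) :
    Differentiable ℝ (f : Euc N → ℝ) :=
  f.contDiff.differentiable (by simp)

variable (p m) in
/-- The test functions `f ∈ 𝓓(Ω)`, embedded as the triples `(f, Df, Df)`. -/
def testSubmodule (Ω : TopologicalSpace.Opens (Euc N)) : Submodule ℝ (Triple N p m) where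
  carrier := {w | ∃ f : 𝓓(Ω, ℝ), Represents w f}
  zero_mem' := by
    refine ⟨0, ?_, ?_, ?_⟩
    · exact Lp.coeFn_zero _ _ _
    · refine (Lp.coeFn_zero _ _ _).trans (Eq.eventuallyEq ?_)
      funext x
      simp [gradient]
    · refine (Lp.coeFn_zero _ _ _).trans (Eq.eventuallyEq ?_)
      funext x
      simp [gradient]
  add_mem' := by
    rintro a b ⟨f, hf1, hf2, hf3⟩ ⟨g, hg1, hg2, hg3⟩
    have hD : ∇ (⇑(f + g)) = ∇ (f : Euc N → ℝ) + ∇ (g : Euc N → ℝ) := by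
      rw [FunLike.coe_add]
      exact gradient_add_of_differentiable (TestFunction_differentiable f)
        (TestFunction_differentiable g)
    refine ⟨f + g, ?_, ?_, ?_⟩
    · rw [FunLike.coe_add]
      exact (Lp.coeFn_add _ _).trans (hf1.add hg1)
    · rw [hD]
      exact (Lp.coeFn_add _ _).trans (hf2.add hg2)
    · rw [hD]
      exact (Lp.coeFn_add _ _).trans (hf3.add hg3)
  smul_mem' := by
    rintro c a ⟨f, hf1, hf2, hf3⟩
    have hD : ∇ (⇑(c • f)) = c • ∇ (f : Euc N → ℝ) := by
      rw [FunLike.coe_smul]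
      exact gradient_smul_of_differentiable c (TestFunction_differentiable f)
    refine ⟨c • f, ?_, ?_, ?_⟩
    · rw [FunLike.coe_smul]
      exact (Lp.coeFn_smul _ _).trans (hf1.const_smul c)
    · rw [hD]
      exact (Lp.coeFn_smul _ _).trans (hf2.const_smul c)
    · rw [hD]
      exact (Lp.coeFn_smul _ _).trans (hf3.const_smul c)

variable (p m) in
/-- The space `W_0^{1,p}(Ω) ∩ D_0^{1,m}(Ω)`: the completion of `𝓓(Ω)` in the norm
`‖w‖_{W^{1,p}} + ‖Dw‖_{L^m}`, realized as the closure of `𝓓(Ω)` in the Banach space of triples.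
Its elements are functions on the whole space which vanish almost everywhere outside `Ω`, so that
extension by zero is built in. -/
def sobolevZero (Ω : TopologicalSpace.Opens (Euc N)) : Submodule ℝ (Triple N p m) :=
  (testSubmodule p m Ω).topologicalClosure

end Space

section Integrand

variable {N : ℕ}

/-- `j(s, ξ) = L(ξ) + M(s, ξ) - G(s)`. -/
def j (L : Euc N → ℝ) (M : ℝ → Euc N → ℝ) (G : ℝ → ℝ) (s : ℝ) (ξ : Euc N) : ℝ :=
  L ξ + M s ξ - G s

/-- The partial derivative `j_s`. -/
def jS (L : Euc N → ℝ) (M : ℝ → Euc N → ℝ) (G : ℝ → ℝ) (s : ℝ) (ξ : Euc N) : ℝ :=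
  deriv (fun t => j L M G t ξ) s

/-- The partial gradient `j_ξ`. -/
def jXi (L : Euc N → ℝ) (M : ℝ → Euc N → ℝ) (G : ℝ → ℝ) (s : ℝ) (ξ : Euc N) : Euc N :=
  ∇ (fun η => j L M G s η) ξ

/-- The partial derivative `M_s`. -/
def partialS (M : ℝ → Euc N → ℝ) (s : ℝ) (ξ : Euc N) : ℝ := deriv (fun t => M t ξ) s

/-- The partial gradient `M_ξ`. -/
def partialXi (M : ℝ → Euc N → ℝ) (s : ℝ) (ξ : Euc N) : Euc N := ∇ (fun η => M s η) ξ

/-- The assumptions on `L`: in the case `p ≤ 2` the gradient is only of class `C¹` off the origin,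
and a uniform bound on `|L_ξ(ξ + h) - L_ξ(ξ)| / |h| ^ (p - 1)` replaces the one on `L_ξξ`. -/
structure AssumptionsL (p ν C : ℝ) (L : Euc N → ℝ) : Prop where
  contDiff : ContDiff ℝ 1 L
  strictConvex : StrictConvexOn ℝ univ L
  lower : ∀ ξ, ν * ‖ξ‖ ^ p ≤ |L ξ|
  upper : ∀ ξ, |L ξ| ≤ C * ‖ξ‖ ^ p
  grad_le : ∀ ξ, ‖∇ L ξ‖ ≤ C * ‖ξ‖ ^ (p - 1)
  sub_contDiff : p ≤ 2 → ContDiffOn ℝ 1 (∇ L) {0}ᶜ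
  sub_holder : p ≤ 2 → ∃ K : ℝ, ∀ ξ h, h ≠ 0 → ‖∇ L (ξ + h) - ∇ L ξ‖ / ‖h‖ ^ (p - 1) ≤ K
  super_contDiff : 2 < p → ContDiff ℝ 2 L
  super_le : 2 < p → ∀ ξ, ‖fderiv ℝ (∇ L) ξ‖ ≤ C * ‖ξ‖ ^ (p - 2)

/-- The assumptions on `M`, including the sign condition `M_s(s, ξ) s ≥ 0`. The field
`contDiff_partialS` says that `M_ss` and `M_sξ` exist and are continuous everywhere. In the case
`m ≤ 2` the gradient `M_ξ` is only of class `C¹` off `ξ = 0`, and a uniform bound on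
`|M_ξ(s, ξ + h) - M_ξ(s, ξ)| / |h| ^ (m - 1)` replaces the one on `M_ξξ`. -/
structure AssumptionsM (m ν C : ℝ) (M : ℝ → Euc N → ℝ) : Prop where
  contDiff : ContDiff ℝ 1 (fun z : ℝ × Euc N => M z.1 z.2)
  strictConvex : ∀ s, StrictConvexOn ℝ univ (M s)
  lower : ∀ s ξ, ν * ‖ξ‖ ^ m ≤ M s ξ
  upper : ∀ s ξ, M s ξ ≤ C * ‖ξ‖ ^ m
  partialS_le : ∀ s ξ, |partialS M s ξ| ≤ C * ‖ξ‖ ^ m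
  partialXi_le : ∀ s ξ, ‖partialXi M s ξ‖ ≤ C * ‖ξ‖ ^ (m - 1)
  contDiff_partialS : ContDiff ℝ 1 (fun z : ℝ × Euc N => partialS M z.1 z.2)
  partialSS_le : ∀ s ξ, |partialS (partialS M) s ξ| ≤ C * ‖ξ‖ ^ m
  partialSXi_le : ∀ s ξ, ‖partialXi (partialS M) s ξ‖ ≤ C * ‖ξ‖ ^ (m - 1)
  sign : ∀ s ξ, 0 ≤ partialS M s ξ * s
  sub_contDiff : m ≤ 2 →
    ContDiffOn ℝ 1 (fun z : ℝ × Euc N => partialXi M z.1 z.2) (univ ×ˢ {0}ᶜ)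
  sub_holder : m ≤ 2 → ∃ K : ℝ, ∀ s ξ h, h ≠ 0 →
    ‖partialXi M s (ξ + h) - partialXi M s ξ‖ / ‖h‖ ^ (m - 1) ≤ K
  super_contDiff : 2 < m → ContDiff ℝ 2 (fun z : ℝ × Euc N => M z.1 z.2)
  super_le : 2 < m → ∀ s ξ, ‖fderiv ℝ (partialXi M s) ξ‖ ≤ C * ‖ξ‖ ^ (m - 2)

/-- The assumptions on `G`, normalized by `G(0) = 0`: in the case `σ ≤ 2` the derivative is only of
class `C¹` off the origin, and a uniform bound on `|G'(s + t) - G'(s)| / |t| ^ (σ - 1)` replaces the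
one on `G''`. -/
structure AssumptionsG (σ C : ℝ) (G : ℝ → ℝ) : Prop where
  contDiff : ContDiff ℝ 1 G
  map_zero : G 0 = 0
  deriv_le : ∀ s, |deriv G s| ≤ C * |s| ^ (σ - 1)
  sub_contDiff : σ ≤ 2 → ContDiffOn ℝ 1 (deriv G) {0}ᶜ
  sub_holder : σ ≤ 2 → ∃ K : ℝ, ∀ s t, t ≠ 0 → |deriv G (s + t) - deriv G s| / |t| ^ (σ - 1) ≤ K
  super_contDiff : 2 < σ → ContDiff ℝ 2 G
  super_le : 2 < σ → ∀ s, |deriv (deriv G) s| ≤ C * |s| ^ (σ - 2)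

/-- The assumptions on the potential `V` on `Ω`, where `Ω` has bounded complement. -/
structure AssumptionsV (Ω : Set (Euc N)) (V : Euc N → ℝ) (Vinf : ℝ) : Prop where
  continuousOn : ContinuousOn V Ω
  tendsto : Tendsto V (Bornology.cobounded (Euc N)) (𝓝 Vinf)
  pos : ∃ V₀ : ℝ, 0 < V₀ ∧ ∀ x ∈ Ω, V₀ ≤ V x
  bounded : ∃ B : ℝ, ∀ x ∈ Ω, V x ≤ B

end Integrand

section Functionals

variable {N : ℕ} {p m : ℝ} [Fact (1 ≤ ENNReal.ofReal p)] [Fact (1 ≤ ENNReal.ofReal m)]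

/-- `∫_D j(w, Dw) + ∫_D V |w| ^ p / p`. This is `φ` for `D = Ω`, and `φ_∞` when `D` is the whole
space and `V` is the constant `V_∞`. -/
def energy (L : Euc N → ℝ) (M : ℝ → Euc N → ℝ) (G : ℝ → ℝ) (D : Set (Euc N)) (V : Euc N → ℝ)
    (w : Triple N p m) : ℝ :=
  (∫ x in D, j L M G (val w x) (grad w x)) + ∫ x in D, V x * (|val w x| ^ p / p)

/-- `∫_D j_ξ(w, Dw) · Dv + ∫_D j_s(w, Dw) v`. -/
def jPairing (L : Euc N → ℝ) (M : ℝ → Euc N → ℝ) (G : ℝ → ℝ) (D : Set (Euc N))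
    (w v : Triple N p m) : ℝ :=
  (∫ x in D, inner ℝ (jXi L M G (val w x) (grad w x)) (grad v x)) +
    ∫ x in D, jS L M G (val w x) (grad w x) * val v x

/-- `∫_D V |w| ^ (p - 2) w v`. -/
def potentialPairing (D : Set (Euc N)) (V : Euc N → ℝ) (w v : Triple N p m) : ℝ :=
  ∫ x in D, V x * |val w x| ^ (p - 2) * val w x * val v x

end Functionals

end

end QuasilinearSplitting

namespace QuasilinearSplitting

set_option linter.unusedSectionVars false

noncomputable section

section Abstract

variable {α : Type*} [MeasurableSpace α] {μ : Measure α}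
  {Y : Type*} [NormedAddCommGroup Y] [NormedSpace ℝ Y]
  {X : Type*} [NormedAddCommGroup X] [NormedSpace ℝ X]
  {Φ : Y → ℝ} {B : Y → Y →L[ℝ] ℝ} {rep : X → α → Y} {c : α → ℝ}

/-- A modular on `Y`, used to measure the size of `Y`-valued functions. -/
structure Modular (Φ : Y → ℝ) : Prop where
  continuous : Continuous Φ
  nonneg : ∀ y, 0 ≤ Φ y
  add_le : ∃ K, 0 ≤ K ∧ ∀ a b, Φ (a + b) ≤ K * (Φ a + Φ b)
  smul_le : ∀ t : ℝ, |t| ≤ 1 → ∀ a, Φ (t • a) ≤ Φ a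
  tendsto_zero : ∀ y : ℕ → Y, Tendsto (fun n => Φ (y n)) atTop (𝓝 0) → Tendsto y atTop (𝓝 0)

/-- A linear map from `X` to almost everywhere classes of functions `α → Y`, given by
representatives, whose modular is controlled by the norm of `X`. -/
structure Representation (μ : Measure α) (Φ : Y → ℝ) (rep : X → α → Y) : Prop where
  aesm : ∀ z, AEStronglyMeasurable (rep z) μ
  add : ∀ z w, ∀ᵐ x ∂μ, rep (z + w) x = rep z x + rep w x
  smul : ∀ (t : ℝ) z, ∀ᵐ x ∂μ, rep (t • z) x = t • rep z x
  integrable : ∀ z, Integrable (fun x => Φ (rep z x)) μ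
  bounded : ∀ R, ∃ K, 0 ≤ K ∧ ∀ z, ‖z‖ ≤ R → ∫ x, Φ (rep z x) ∂μ ≤ K
  small : Tendsto (fun z => ∫ x, Φ (rep z x) ∂μ) (𝓝 0) (𝓝 0)

/-- A bounded measurable weight. -/
structure Weight (μ : Measure α) (c : α → ℝ) : Prop where
  aesm : AEStronglyMeasurable c μ
  bounded : ∃ κ, 0 ≤ κ ∧ ∀ᵐ x ∂μ, |c x| ≤ κ

/-- Fields of linear forms on `Y` which are subordinate to the modular `Φ` and which satisfy an
inequality of Brezis–Lieb type. -/
structure Admissible (Φ : Y → ℝ) (B : Y → Y →L[ℝ] ℝ) : Prop where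
  continuous : Continuous B
  map_zero : B 0 = 0
  weak : ∀ δ > 0, ∃ C, 0 ≤ C ∧ ∀ y h, |B y h| ≤ δ * Φ y + C * Φ h
  strong : ∀ δ > 0, ∃ C, 0 ≤ C ∧ ∀ y h, |B y h| ≤ C * Φ y + δ * Φ h
  splitting : ∃ D : Y → Y → ℝ, Continuous (fun z : Y × Y => D z.1 z.2) ∧ (∀ a b, 0 ≤ D a b) ∧
    (∀ b, D 0 b = 0) ∧
    (∀ ε > 0, ∃ C, 0 ≤ C ∧ ∀ a b, D a b ≤ ε * Φ a + C * Φ b) ∧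
    ∀ δ > 0, ∃ C, 0 ≤ C ∧ ∀ a b h,
      |B a h - B (a + b) h + B b h| ≤ C * D a b + δ * Φ h

theorem Modular.map_smul_add_le (hΦ : Modular Φ) :
    ∃ K, 0 ≤ K ∧ ∀ (t : ℝ), |t| ≤ 1 → ∀ a b, Φ (a + t • b) ≤ K * (Φ a + Φ b) := by
  obtain ⟨K, hK, h⟩ := hΦ.add_le
  refine ⟨K, hK, fun t ht a b => (h _ _).trans ?_⟩
  gcongr
  exact hΦ.smul_le t ht b

theorem Representation.sub (hR : Representation μ Φ rep) (z w : X) :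
    ∀ᵐ x ∂μ, rep (z - w) x = rep z x - rep w x := by
  filter_upwards [hR.add z ((-1 : ℝ) • w), hR.smul (-1) w] with x h1 h2
  rw [sub_eq_add_neg, ← neg_one_smul ℝ w, h1, h2, neg_one_smul, sub_eq_add_neg]

theorem Representation.add_smul (hR : Representation μ Φ rep) (t : ℝ) (z w : X) :
    ∀ᵐ x ∂μ, rep (z + t • w) x = rep z x + t • rep w x := by
  filter_upwards [hR.add z (t • w), hR.smul t w] with x h1 h2
  rw [h1, h2]

theorem Admissible.add {B' : Y → Y →L[ℝ] ℝ} (h : Admissible Φ B)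
    (h' : Admissible Φ B') : Admissible Φ (fun y => B y + B' y) := by
  refine ⟨h.continuous.add h'.continuous, by simp [h.map_zero, h'.map_zero], ?_, ?_, ?_⟩
  · intro δ hδ
    obtain ⟨C, hC, hh⟩ := h.weak (δ / 2) (by positivity)
    obtain ⟨C', hC', hh'⟩ := h'.weak (δ / 2) (by positivity)
    refine ⟨C + C', by positivity, fun y k => ?_⟩
    have := abs_add_le (B y k) (B' y k)
    simp only [add_apply]
    linarith [hh y k, hh' y k]
  · intro δ hδ
    obtain ⟨C, hC, hh⟩ := h.strong (δ / 2) (by positivity)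
    obtain ⟨C', hC', hh'⟩ := h'.strong (δ / 2) (by positivity)
    refine ⟨C + C', by positivity, fun y k => ?_⟩
    have := abs_add_le (B y k) (B' y k)
    simp only [add_apply]
    linarith [hh y k, hh' y k]
  · obtain ⟨D, hDc, hDn, hD0, hDε, hDδ⟩ := h.splitting
    obtain ⟨D', hDc', hDn', hD0', hDε', hDδ'⟩ := h'.splitting
    refine ⟨fun a b => D a b + D' a b, hDc.add hDc', fun a b => add_nonneg (hDn a b) (hDn' a b),
      fun b => by simp [hD0, hD0'], ?_, ?_⟩
    · intro ε hε
      obtain ⟨C, hC, hh⟩ := hDε (ε / 2) (by positivity)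
      obtain ⟨C', hC', hh'⟩ := hDε' (ε / 2) (by positivity)
      refine ⟨C + C', by positivity, fun a b => ?_⟩
      linarith [hh a b, hh' a b]
    · intro δ hδ
      obtain ⟨C, hC, hh⟩ := hDδ (δ / 2) (by positivity)
      obtain ⟨C', hC', hh'⟩ := hDδ' (δ / 2) (by positivity)
      refine ⟨C + C', by positivity, fun a b k => ?_⟩
      have := abs_add_le (B a k - B (a + b) k + B b k) (B' a k - B' (a + b) k + B' b k)
      have e : (B a + B' a) k - (B (a + b) + B' (a + b)) k + (B b + B' b) k =
        (B a k - B (a + b) k + B b k) + (B' a k - B' (a + b) k + B' b k) := by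
        simp only [add_apply]; ring
      rw [e]
      nlinarith [hh a b k, hh' a b k, mul_nonneg hC (hDn' a b), mul_nonneg hC' (hDn a b)]

/-- Functions which tend to zero almost everywhere and are dominated, up to a small multiple of an
`L¹`-bounded sequence, by an integrable function, tend to zero in `L¹`. -/
theorem tendsto_integral_abs_of_le_add {f g : ℕ → α → ℝ} {K : ℝ}
    (hf : ∀ n, AEStronglyMeasurable (f n) μ)
    (hlim : ∀ᵐ x ∂μ, Tendsto (fun n => f n x) atTop (𝓝 0))
    (hg : ∀ n, Integrable (g n) μ) (hgn : ∀ n, ∀ᵐ x ∂μ, 0 ≤ g n x)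
    (hgK : ∀ n, ∫ x, g n x ∂μ ≤ K)
    (hbound : ∀ ε > 0, ∃ F : α → ℝ, Integrable F μ ∧ ∀ n, ∀ᵐ x ∂μ, |f n x| ≤ ε * g n x + F x) :
    Tendsto (fun n => ∫ x, |f n x| ∂μ) atTop (𝓝 0) := by
  have hK : 0 ≤ K := (integral_nonneg_of_ae (hgn 0)).trans (hgK 0)
  rw [Metric.tendsto_atTop]
  intro ε hε
  have hε' : 0 < ε / (2 * (K + 1)) := by positivity
  obtain ⟨F, hF, hb⟩ := hbound _ hε'
  have hdom : Tendsto (fun n => ∫ x, min |f n x| |F x| ∂μ) atTop (𝓝 (∫ _, (0 : ℝ) ∂μ)) := by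
    refine tendsto_integral_of_dominated_convergence (fun x => |F x|) (fun n => ?_) hF.abs
      (fun n => ?_) ?_
    · exact (hf n).norm.inf hF.abs.aestronglyMeasurable
    · filter_upwards with x
      rw [Real.norm_of_nonneg (by positivity)]
      exact min_le_right _ _
    · filter_upwards [hlim] with x hx
      refine squeeze_zero (fun n => by positivity) (fun n => min_le_left _ _) ?_
      simpa using hx.abs
  rw [integral_zero, Metric.tendsto_atTop] at hdom
  obtain ⟨n₀, hn₀⟩ := hdom (ε / 2) (by positivity)
  refine ⟨n₀, fun n hn => ?_⟩
  have h1 := hn₀ n hn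
  rw [Real.dist_eq, sub_zero] at h1 ⊢
  have hmin : Integrable (fun x => min |f n x| |F x|) μ := by
    refine hF.abs.mono ((hf n).norm.inf hF.abs.aestronglyMeasurable) ?_
    filter_upwards with x
    rw [Real.norm_of_nonneg (by positivity), Real.norm_of_nonneg (abs_nonneg _)]
    exact min_le_right _ _
  have h2 : ∫ x, |f n x| ∂μ ≤ ∫ x, (ε / (2 * (K + 1)) * g n x + min |f n x| |F x|) ∂μ := by
    refine integral_mono_of_nonneg (by filter_upwards with x; positivity)
      (((hg n).const_mul _).add hmin) ?_
    filter_upwards [hb n, hgn n] with x h3 h4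
    rcases le_total |f n x| |F x| with h | h
    · rw [min_eq_left h]
      nlinarith [mul_nonneg hε'.le h4]
    · rw [min_eq_right h]
      linarith [le_abs_self (F x)]
  rw [integral_add ((hg n).const_mul _) hmin, integral_const_mul] at h2
  have h5 : ε / (2 * (K + 1)) * ∫ x, g n x ∂μ < ε / 2 := by
    calc ε / (2 * (K + 1)) * ∫ x, g n x ∂μ ≤ ε / (2 * (K + 1)) * K := by gcongr; exact hgK n
      _ < ε / (2 * (K + 1)) * (K + 1) := by gcongr; linarith
      _ = ε / 2 := by field_simp
  rw [abs_of_nonneg (integral_nonneg fun x => abs_nonneg _)]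
  linarith [le_abs_self (∫ x, min |f n x| |F x| ∂μ)]

theorem Admissible.integrable (hc : Weight μ c) (hB : Admissible Φ B) {y h : α → Y}
    (hy : AEStronglyMeasurable y μ) (hyi : Integrable (fun x => Φ (y x)) μ)
    (hh : AEStronglyMeasurable h μ) (hhi : Integrable (fun x => Φ (h x)) μ) :
    Integrable (fun x => c x * B (y x) (h x)) μ := by
  obtain ⟨κ, hκ, hcκ⟩ := hc.bounded
  obtain ⟨C, hC, hb⟩ := hB.strong 1 one_pos
  refine Integrable.mono' ((hyi.const_mul C).add (hhi.const_mul 1) |>.const_mul κ) ?_ ?_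
  · have hcont : Continuous fun z : Y × Y => B z.1 z.2 :=
      (hB.continuous.comp continuous_fst).clm_apply continuous_snd
    exact hc.aesm.mul (hcont.comp_aestronglyMeasurable (hy.prodMk hh))
  · filter_upwards [hcκ] with x hx
    rw [norm_mul, Real.norm_eq_abs, Real.norm_eq_abs]
    exact mul_le_mul hx (hb _ _) (abs_nonneg _) hκ

/-- A linear functional which is bounded on the unit ball. -/
theorem LinearMap_abs_le_of_unit_ball (ℓ : X →ₗ[ℝ] ℝ) {b : ℝ}
    (h : ∀ v, ‖v‖ ≤ 1 → |ℓ v| ≤ b) (v : X) : |ℓ v| ≤ b * ‖v‖ := by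
  rcases eq_or_ne v 0 with rfl | hv
  · simp
  · have hv' : 0 < ‖v‖ := norm_pos_iff.2 hv
    have h1 := h (‖v‖⁻¹ • v) (by rw [norm_smul, norm_inv, norm_norm, inv_mul_cancel₀ hv'.ne'])
    rw [map_smul, smul_eq_mul, abs_mul, abs_inv, abs_norm] at h1
    rwa [inv_mul_le_iff₀ hv', mul_comm] at h1

theorem exists_pairing (hR : Representation μ Φ rep) (hc : Weight μ c) (hB : Admissible Φ B)
    (z : X) : ∃ A : X →L[ℝ] ℝ, ∀ v, A v = ∫ x, c x * B (rep z x) (rep v x) ∂μ := by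
  have hint : ∀ v, Integrable (fun x => c x * B (rep z x) (rep v x)) μ := fun v =>
    hB.integrable hc (hR.aesm z) (hR.integrable z) (hR.aesm v) (hR.integrable v)
  let ℓ : X →ₗ[ℝ] ℝ :=
    { toFun := fun v => ∫ x, c x * B (rep z x) (rep v x) ∂μ
      map_add' := fun v w => by
        rw [← integral_add (hint v) (hint w)]
        refine integral_congr_ae ?_
        filter_upwards [hR.add v w] with x hx
        rw [hx, map_add, mul_add]
      map_smul' := fun t v => by
        simp only [RingHom.id_apply, smul_eq_mul]
        rw [← integral_const_mul]
        refine integral_congr_ae ?_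
        filter_upwards [hR.smul t v] with x hx
        rw [hx, map_smul, smul_eq_mul]
        ring }
  obtain ⟨κ, hκ, hcκ⟩ := hc.bounded
  obtain ⟨C, hC, hb⟩ := hB.strong 1 one_pos
  obtain ⟨K, hK, hball⟩ := hR.bounded 1
  refine ⟨ℓ.mkContinuous (κ * (C * ∫ x, Φ (rep z x) ∂μ + 1 * K)) fun v => ?_, fun v => rfl⟩
  refine LinearMap_abs_le_of_unit_ball ℓ (b := κ * (C * ∫ x, Φ (rep z x) ∂μ + 1 * K))
    (fun v hv => ?_) v
  calc |∫ x, c x * B (rep z x) (rep v x) ∂μ| ≤ ∫ x, κ * (C * Φ (rep z x) + 1 * Φ (rep v x)) ∂μ := by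
        refine norm_integral_le_of_norm_le
          (f := fun x => c x * B (rep z x) (rep v x))
          (g := fun x => κ * (C * Φ (rep z x) + 1 * Φ (rep v x)))
          (((hR.integrable z).const_mul C).add ((hR.integrable v).const_mul 1) |>.const_mul κ) ?_
        filter_upwards [hcκ] with x hx
        rw [norm_mul, Real.norm_eq_abs, Real.norm_eq_abs]
        exact mul_le_mul hx (hb _ _) (abs_nonneg _) hκ
    _ = κ * (C * ∫ x, Φ (rep z x) ∂μ + 1 * ∫ x, Φ (rep v x) ∂μ) := by
        rw [integral_const_mul, integral_add ((hR.integrable z).const_mul C)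
          ((hR.integrable v).const_mul 1), integral_const_mul, integral_const_mul]
    _ ≤ κ * (C * ∫ x, Φ (rep z x) ∂μ + 1 * K) := by gcongr; exact hball v hv

/-- The functional `v ↦ ∫ c(x) B(z(x)) v(x)`. -/
def pairing (hR : Representation μ Φ rep) (hc : Weight μ c) (hB : Admissible Φ B) (z : X) :
    X →L[ℝ] ℝ := (exists_pairing hR hc hB z).choose

theorem pairing_apply (hR : Representation μ Φ rep) (hc : Weight μ c) (hB : Admissible Φ B)
    (z v : X) : pairing hR hc hB z v = ∫ x, c x * B (rep z x) (rep v x) ∂μ :=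
  (exists_pairing hR hc hB z).choose_spec v

theorem pairing_add (hR : Representation μ Φ rep) {c c' c'' : α → ℝ} (hc : Weight μ c)
    (hc' : Weight μ c') (hc'' : Weight μ c'') (hB : Admissible Φ B) (h : ∀ x, c x + c' x = c'' x)
    (z : X) : pairing hR hc'' hB z = pairing hR hc hB z + pairing hR hc' hB z := by
  refine ContinuousLinearMap.ext fun v => ?_
  rw [add_apply, pairing_apply, pairing_apply, pairing_apply,
    ← integral_add (hB.integrable hc (hR.aesm z) (hR.integrable z) (hR.aesm v) (hR.integrable v))
      (hB.integrable hc' (hR.aesm z) (hR.integrable z) (hR.aesm v) (hR.integrable v))]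
  refine integral_congr_ae (Eventually.of_forall fun x => ?_)
  simp only [← h]
  ring

theorem tendsto_dual_zero_of_abs_le (hR : Representation μ Φ rep) {ℓ : ℕ → X →L[ℝ] ℝ} {s : ℕ → ℝ}
    (hs : Tendsto s atTop (𝓝 0))
    (h : ∀ δ > 0, ∃ C, 0 ≤ C ∧ ∀ n v, |ℓ n v| ≤ C * s n + δ * ∫ x, Φ (rep v x) ∂μ) :
    Tendsto ℓ atTop (𝓝 0) := by
  obtain ⟨K, hK, hball⟩ := hR.bounded 1
  rw [Metric.tendsto_atTop]
  intro ε hε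
  obtain ⟨C, hC, hb⟩ := h (ε / (4 * (K + 1))) (by positivity)
  obtain ⟨n₀, hn₀⟩ := Metric.tendsto_atTop.1 hs (ε / (4 * (C + 1))) (by positivity)
  refine ⟨n₀, fun n hn => ?_⟩
  rw [dist_zero_right]
  have h1 := hn₀ n hn
  rw [Real.dist_eq, sub_zero] at h1
  have h2 : ‖ℓ n‖ ≤ ε / 2 := by
    refine ContinuousLinearMap.opNorm_le_bound _ (by positivity) fun v => ?_
    refine LinearMap_abs_le_of_unit_ball (ℓ n : X →ₗ[ℝ] ℝ) (fun v hv => ?_) v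
    have h3 := hb n v
    have h4 : C * s n ≤ ε / 4 := by
      calc C * s n ≤ (C + 1) * (ε / (4 * (C + 1))) := by
            refine (mul_le_mul_of_nonneg_left ((le_abs_self _).trans h1.le) hC).trans ?_
            gcongr
            linarith
        _ = ε / 4 := by field_simp
    have h5 : ε / (4 * (K + 1)) * ∫ x, Φ (rep v x) ∂μ ≤ ε / 4 := by
      calc ε / (4 * (K + 1)) * ∫ x, Φ (rep v x) ∂μ ≤ ε / (4 * (K + 1)) * (K + 1) := by
            gcongr
            linarith [hball v hv]
        _ = ε / 4 := by field_simp
    simp only [ContinuousLinearMap.coe_coe]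
    linarith
  linarith

/-- The functionals `v ↦ ∫ c Δₙ v` tend to zero in norm if `c Δₙ` is controlled in `L¹`. -/
theorem tendsto_dual_zero_of_pointwise (hR : Representation μ Φ rep)
    {ℓ : ℕ → X →L[ℝ] ℝ} {f : ℕ → α → ℝ} {k : ℕ → X → α → ℝ}
    (hℓ : ∀ n v, ℓ n v = ∫ x, k n v x ∂μ) (hfi : ∀ n, Integrable (f n) μ)
    (hf : Tendsto (fun n => ∫ x, |f n x| ∂μ) atTop (𝓝 0))
    (h : ∀ δ > 0, ∃ C, 0 ≤ C ∧ ∀ n v, ∀ᵐ x ∂μ, |k n v x| ≤ C * |f n x| + δ * Φ (rep v x)) :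
    Tendsto ℓ atTop (𝓝 0) := by
  refine tendsto_dual_zero_of_abs_le hR hf fun δ hδ => ?_
  obtain ⟨C, hC, hb⟩ := h δ hδ
  refine ⟨C, hC, fun n v => ?_⟩
  rw [hℓ, ← integral_const_mul, ← integral_const_mul,
    ← integral_add ((hfi n).abs.const_mul C) ((hR.integrable v).const_mul δ)]
  exact norm_integral_le_of_norm_le (f := k n v)
    (g := fun x => C * |f n x| + δ * Φ (rep v x))
    (((hfi n).abs.const_mul C).add ((hR.integrable v).const_mul δ)) (hb n v)

/-- Bounded sequences converging almost everywhere split the functionals `pairing`. -/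
theorem tendsto_pairing_splitting (hΦ : Modular Φ) (hR : Representation μ Φ rep)
    (hc : Weight μ c) (hB : Admissible Φ B) {u : ℕ → X} {u₀ : X} {R : ℝ} (hu : ∀ n, ‖u n‖ ≤ R)
    (hae : ∀ᵐ x ∂μ, Tendsto (fun n => rep (u n) x) atTop (𝓝 (rep u₀ x))) :
    Tendsto (fun n => pairing hR hc hB (u n - u₀) - pairing hR hc hB (u n) + pairing hR hc hB u₀)
      atTop (𝓝 0) := by
  obtain ⟨D, hDc, hDn, hD0, hDε, hDδ⟩ := hB.splitting
  obtain ⟨κ, hκ, hcκ⟩ := hc.bounded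
  obtain ⟨K, hK, hball⟩ := hR.bounded (R + ‖u₀‖)
  have hmeas : ∀ n, AEStronglyMeasurable (fun x => D (rep (u n - u₀) x) (rep u₀ x)) μ := fun n =>
    hDc.comp_aestronglyMeasurable ((hR.aesm _).prodMk (hR.aesm _))
  have hint : ∀ z v, Integrable (fun x => c x * B (rep z x) (rep v x)) μ := fun z v =>
    hB.integrable hc (hR.aesm z) (hR.integrable z) (hR.aesm v) (hR.integrable v)
  refine tendsto_dual_zero_of_pointwise hR
    (f := fun n x => D (rep (u n - u₀) x) (rep u₀ x))
    (k := fun n v x => c x * B (rep (u n - u₀) x) (rep v x) - c x * B (rep (u n) x) (rep v x)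
      + c x * B (rep u₀ x) (rep v x)) (fun n v => ?_) (fun n => ?_) ?_ (fun δ hδ => ?_)
  · rw [add_apply, sub_apply, pairing_apply, pairing_apply,
      pairing_apply, ← integral_sub (hint _ _) (hint _ _),
      ← integral_add (f := fun x => c x * B (rep (u n - u₀) x) (rep v x)
        - c x * B (rep (u n) x) (rep v x)) ((hint _ _).sub (hint _ _)) (hint _ _)]
  · obtain ⟨C, hC, hb⟩ := hDε 1 one_pos
    refine Integrable.mono' (((hR.integrable (u n - u₀)).const_mul 1).add
      ((hR.integrable u₀).const_mul C)) (hmeas n) ?_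
    filter_upwards with x
    rw [Real.norm_of_nonneg (hDn _ _)]
    exact hb _ _
  · refine tendsto_integral_abs_of_le_add (g := fun n x => Φ (rep (u n - u₀) x)) (K := K) hmeas ?_
      (fun n => hR.integrable _) (fun n => ?_) (fun n => ?_) (fun ε hε => ?_)
    · filter_upwards [hae, ae_all_iff.2 fun n => hR.sub (u n) u₀] with x hx hs
      have h1 : Tendsto (fun n => rep (u n - u₀) x) atTop (𝓝 0) := by
        simp_rw [hs]
        simpa using hx.sub_const (rep u₀ x)
      have h2 := (hDc.tendsto (0, rep u₀ x)).comp (h1.prodMk_nhds tendsto_const_nhds)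
      rw [hD0] at h2
      exact h2
    · filter_upwards with x using hΦ.nonneg _
    · exact hball _ ((norm_sub_le _ _).trans (by linarith [hu n]))
    · obtain ⟨C, hC, hb⟩ := hDε ε hε
      refine ⟨fun x => C * Φ (rep u₀ x), (hR.integrable u₀).const_mul C, fun n => ?_⟩
      filter_upwards with x
      rw [abs_of_nonneg (hDn _ _)]
      exact hb _ _
  · obtain ⟨C, hC, hb⟩ := hDδ (δ / (κ + 1)) (by positivity)
    refine ⟨κ * C, by positivity, fun n v => ?_⟩
    filter_upwards [hR.sub (u n) u₀, hcκ] with x hs hx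
    have h1 := hb (rep (u n - u₀) x) (rep u₀ x) (rep v x)
    have h2 : rep (u n - u₀) x + rep u₀ x = rep (u n) x := by rw [hs]; abel
    rw [h2] at h1
    rw [abs_of_nonneg (hDn _ _)]
    have h3 : c x * B (rep (u n - u₀) x) (rep v x) - c x * B (rep (u n) x) (rep v x)
        + c x * B (rep u₀ x) (rep v x) = c x * (B (rep (u n - u₀) x) (rep v x)
        - B (rep (u n) x) (rep v x) + B (rep u₀ x) (rep v x)) := by ring
    rw [h3, abs_mul]
    calc _ ≤ κ * (C * D (rep (u n - u₀) x) (rep u₀ x) + δ / (κ + 1) * Φ (rep v x)) :=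
          mul_le_mul hx h1 (abs_nonneg _) hκ
      _ ≤ _ := by
        have h4 : κ * (δ / (κ + 1)) ≤ δ := by
          rw [← mul_div_assoc, div_le_iff₀ (by positivity)]
          nlinarith
        nlinarith [mul_le_mul_of_nonneg_right h4 (hΦ.nonneg (rep v x))]

/-- Bounded sequences converging to zero almost everywhere are mapped to sequences of functionals
converging weakly-* to zero. -/
theorem tendsto_pairing_weak_zero (hΦ : Modular Φ) (hR : Representation μ Φ rep)
    (hc : Weight μ c) (hB : Admissible Φ B) {a : ℕ → X} {R : ℝ} (ha : ∀ n, ‖a n‖ ≤ R)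
    (hae : ∀ᵐ x ∂μ, Tendsto (fun n => rep (a n) x) atTop (𝓝 0)) (v : X) :
    Tendsto (fun n => pairing hR hc hB (a n) v) atTop (𝓝 0) := by
  obtain ⟨κ, hκ, hcκ⟩ := hc.bounded
  obtain ⟨K, hK, hball⟩ := hR.bounded R
  have hint : ∀ z v, Integrable (fun x => c x * B (rep z x) (rep v x)) μ := fun z v =>
    hB.integrable hc (hR.aesm z) (hR.integrable z) (hR.aesm v) (hR.integrable v)
  have key : Tendsto (fun n => ∫ x, |c x * B (rep (a n) x) (rep v x)| ∂μ) atTop (𝓝 0) := by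
    refine tendsto_integral_abs_of_le_add (g := fun n x => Φ (rep (a n) x)) (K := K)
      (fun n => (hint _ _).aestronglyMeasurable) ?_ (fun n => hR.integrable _) (fun n => ?_)
      (fun n => hball _ (ha n)) (fun ε hε => ?_)
    · filter_upwards [hae] with x hx
      have h1 : Tendsto (fun n => B (rep (a n) x) (rep v x)) atTop (𝓝 (B 0 (rep v x))) :=
        ((hB.continuous.clm_apply continuous_const).tendsto 0).comp hx
      simpa [hB.map_zero] using h1.const_mul (c x)
    · filter_upwards with x using hΦ.nonneg _
    · obtain ⟨C, hC, hb⟩ := hB.weak (ε / (κ + 1)) (by positivity)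
      refine ⟨fun x => κ * C * Φ (rep v x), (hR.integrable v).const_mul _, fun n => ?_⟩
      filter_upwards [hcκ] with x hx
      rw [abs_mul]
      calc _ ≤ κ * (ε / (κ + 1) * Φ (rep (a n) x) + C * Φ (rep v x)) :=
            mul_le_mul hx (hb _ _) (abs_nonneg _) hκ
        _ ≤ _ := by
          have h4 : κ * (ε / (κ + 1)) ≤ ε := by
            rw [← mul_div_assoc, div_le_iff₀ (by positivity)]
            nlinarith
          nlinarith [mul_le_mul_of_nonneg_right h4 (hΦ.nonneg (rep (a n) x))]
  refine squeeze_zero_norm (fun n => ?_) key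
  rw [pairing_apply]
  exact norm_integral_le_integral_norm _

theorem tendsto_pairing_of_tendsto_zero (hΦ : Modular Φ) (hR : Representation μ Φ rep)
    (hc : Weight μ c) (hB : Admissible Φ B) {a : ℕ → X} (ha : Tendsto a atTop (𝓝 0)) :
    Tendsto (fun n => pairing hR hc hB (a n)) atTop (𝓝 0) := by
  obtain ⟨κ, hκ, hcκ⟩ := hc.bounded
  refine tendsto_dual_zero_of_pointwise hR (f := fun n x => Φ (rep (a n) x))
    (fun n v => pairing_apply hR hc hB (a n) v) (fun n => hR.integrable _) ?_ (fun δ hδ => ?_)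
  · simp_rw [abs_of_nonneg (hΦ.nonneg _)]
    exact hR.small.comp ha
  · obtain ⟨C, hC, hb⟩ := hB.strong (δ / (κ + 1)) (by positivity)
    refine ⟨κ * C, by positivity, fun n v => ?_⟩
    filter_upwards [hcκ] with x hx
    rw [abs_mul, abs_of_nonneg (hΦ.nonneg _)]
    calc _ ≤ κ * (C * Φ (rep (a n) x) + δ / (κ + 1) * Φ (rep v x)) :=
          mul_le_mul hx (hb _ _) (abs_nonneg _) hκ
      _ ≤ _ := by
        have h4 : κ * (δ / (κ + 1)) ≤ δ := by
          rw [← mul_div_assoc, div_le_iff₀ (by positivity)]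
          nlinarith
        nlinarith [mul_le_mul_of_nonneg_right h4 (hΦ.nonneg (rep v x))]

/-- Convergence in `X` implies convergence almost everywhere along a subsequence. -/
theorem Representation.exists_subseq_tendsto_ae (hΦ : Modular Φ) (hR : Representation μ Φ rep)
    {z : ℕ → X} {z₀ : X} (hz : Tendsto z atTop (𝓝 z₀)) :
    ∃ ns : ℕ → ℕ, StrictMono ns ∧
      ∀ᵐ x ∂μ, Tendsto (fun n => rep (z (ns n)) x) atTop (𝓝 (rep z₀ x)) := by
  have h0 : Tendsto (fun n => z n - z₀) atTop (𝓝 0) := by simpa using hz.sub_const z₀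
  have h1 : Tendsto (fun n => ∫ x, Φ (rep (z n - z₀) x) ∂μ) atTop (𝓝 0) := hR.small.comp h0
  have h2 : TendstoInMeasure μ (fun n x => Φ (rep (z n - z₀) x)) atTop (fun _ => (0 : ℝ)) := by
    refine tendstoInMeasure_of_tendsto_eLpNorm one_ne_zero
      (fun n => (hR.integrable _).aestronglyMeasurable) aestronglyMeasurable_const ?_
    have h3 : ∀ n, eLpNorm ((fun x => Φ (rep (z n - z₀) x)) - fun _ => (0 : ℝ)) 1 μ
        = ENNReal.ofReal (∫ x, Φ (rep (z n - z₀) x) ∂μ) := fun n => by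
      rw [eLpNorm_one_eq_lintegral_enorm, ofReal_integral_eq_lintegral_ofReal (hR.integrable _)
        (by filter_upwards with x using hΦ.nonneg _)]
      refine lintegral_congr fun x => ?_
      simp only [Pi.sub_apply, sub_zero]
      rw [Real.enorm_eq_ofReal (hΦ.nonneg _)]
    simp_rw [h3]
    simpa using ENNReal.tendsto_ofReal h1
  obtain ⟨ns, hns, hlim⟩ := h2.exists_seq_tendsto_ae
  refine ⟨ns, hns, ?_⟩
  filter_upwards [hlim, ae_all_iff.2 fun n => hR.sub (z n) z₀] with x hx hs
  have h4 := hΦ.tendsto_zero _ hx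
  simp_rw [hs] at h4
  simpa using h4.add_const (rep z₀ x)

theorem continuousAt_pairing (hΦ : Modular Φ) (hR : Representation μ Φ rep)
    (hc : Weight μ c) (hB : Admissible Φ B) (z₀ : X) :
    ContinuousAt (fun z => pairing hR hc hB z) z₀ := by
  refine tendsto_of_seq_tendsto fun z hz => tendsto_of_subseq_tendsto fun ns hns => ?_
  have hz' : Tendsto (fun n => z (ns n)) atTop (𝓝 z₀) := hz.comp hns
  obtain ⟨ms, hms, hae⟩ := hR.exists_subseq_tendsto_ae hΦ hz'
  refine ⟨ms, ?_⟩
  have hz'' : Tendsto (fun n => z (ns (ms n))) atTop (𝓝 z₀) := hz'.comp hms.tendsto_atTop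
  obtain ⟨R, hR'⟩ := hz''.norm.bddAbove_range
  have h1 := tendsto_pairing_splitting hΦ hR hc hB (u := fun n => z (ns (ms n))) (u₀ := z₀)
    (fun n => hR' (mem_range_self n)) hae
  have h2 := tendsto_pairing_of_tendsto_zero hΦ hR hc hB (a := fun n => z (ns (ms n)) - z₀)
    (by simpa using hz''.sub_const z₀)
  have h3 := (h2.sub h1).add_const (pairing hR hc hB z₀)
  simp only [sub_zero, zero_add] at h3
  refine h3.congr fun n => ?_
  abel

/-- An integrand with admissible derivative is controlled by the modular. -/
theorem Admissible.abs_le (hΦ : Modular Φ) (hB : Admissible Φ B) {e : Y → ℝ}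
    (he : ∀ y, HasFDerivAt e (B y) y) (he0 : e 0 = 0) : ∃ C, ∀ y, |e y| ≤ C * Φ y := by
  obtain ⟨C, hC, hb⟩ := hB.strong 1 one_pos
  refine ⟨C + 1, fun y => ?_⟩
  have h := Convex.norm_image_sub_le_of_norm_hasDerivWithin_le (s := Icc (0 : ℝ) 1)
    (f := fun t : ℝ => e (t • y)) (f' := fun t => B (t • y) y) (C := (C + 1) * Φ y)
    (x := 0) (y := 1) (fun t _ => ?_) (fun t ht => ?_) (convex_Icc 0 1) (by simp) (by simp)
  · simpa [he0] using h
  · have h1 : HasDerivAt (fun t : ℝ => t • y) y t := by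
      simpa using (hasDerivAt_id t).smul_const y
    exact ((he (t • y)).comp_hasDerivAt t h1).hasDerivWithinAt
  · have h2 := hΦ.smul_le t (_root_.abs_le.2 ⟨by linarith [ht.1], ht.2⟩) y
    rw [Real.norm_eq_abs]
    nlinarith [hb (t • y) y]

theorem Admissible.integrable_energy (hΦ : Modular Φ) (hB : Admissible Φ B) (hc : Weight μ c)
    {e : Y → ℝ} (he : ∀ y, HasFDerivAt e (B y) y) (he0 : e 0 = 0) {y : α → Y}
    (hy : AEStronglyMeasurable y μ) (hyi : Integrable (fun x => Φ (y x)) μ) :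
    Integrable (fun x => c x * e (y x)) μ := by
  obtain ⟨κ, hκ, hcκ⟩ := hc.bounded
  obtain ⟨C, hC⟩ := hB.abs_le hΦ he he0
  have hcont : Continuous e := continuous_iff_continuousAt.2 fun y => (he y).continuousAt
  refine Integrable.mono' ((hyi.const_mul C).const_mul κ)
    (hc.aesm.mul (hcont.comp_aestronglyMeasurable hy)) ?_
  filter_upwards [hcκ] with x hx
  rw [norm_mul, Real.norm_eq_abs, Real.norm_eq_abs]
  exact mul_le_mul hx (hC _) (abs_nonneg _) hκ

theorem hasDerivAt_integral_line (hΦ : Modular Φ) (hR : Representation μ Φ rep)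
    (hc : Weight μ c) (hB : Admissible Φ B) {e : Y → ℝ} (he : ∀ y, HasFDerivAt e (B y) y)
    (he0 : e 0 = 0) (z h : X) :
    HasDerivAt (fun t : ℝ => ∫ x, c x * e (rep (z + t • h) x) ∂μ) (pairing hR hc hB z h) 0 := by
  obtain ⟨κ, hκ, hcκ⟩ := hc.bounded
  obtain ⟨C, hC, hb⟩ := hB.strong 1 one_pos
  obtain ⟨K, hK, hadd⟩ := hΦ.map_smul_add_le
  have hcont : Continuous e := continuous_iff_continuousAt.2 fun y => (he y).continuousAt
  have hmeas : ∀ t : ℝ, AEStronglyMeasurable (fun x => rep z x + t • rep h x) μ := fun t =>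
    (hR.aesm z).add ((hR.aesm h).const_smul t)
  have key := hasDerivAt_integral_of_dominated_loc_of_deriv_le (𝕜 := ℝ) (μ := μ) (x₀ := 0)
    (s := Ioo (-1) 1) (F := fun t x => c x * e (rep z x + t • rep h x))
    (F' := fun t x => c x * B (rep z x + t • rep h x) (rep h x))
    (bound := fun x => κ * (C * (K * (Φ (rep z x) + Φ (rep h x))) + 1 * Φ (rep h x)))
    (Ioo_mem_nhds (by norm_num) (by norm_num)) ?_ ?_ ?_ ?_ ?_ ?_
  · have h1 := key.2
    simp only [zero_smul, add_zero] at h1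
    rw [← pairing_apply hR hc hB] at h1
    refine h1.congr_of_eventuallyEq (Eventually.of_forall fun t => integral_congr_ae ?_)
    filter_upwards [hR.add_smul t z h] with x hx
    simp only [hx]
  · exact Eventually.of_forall fun t =>
      hc.aesm.mul (hcont.comp_aestronglyMeasurable (hmeas t))
  · simp only [zero_smul, add_zero]
    exact hB.integrable_energy hΦ hc he he0 (hR.aesm z) (hR.integrable z)
  · simp only [zero_smul, add_zero]
    exact (hB.integrable hc (hR.aesm z) (hR.integrable z) (hR.aesm h)
      (hR.integrable h)).aestronglyMeasurable
  · filter_upwards [hcκ] with x hx t ht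
    rw [norm_mul, Real.norm_eq_abs, Real.norm_eq_abs]
    refine mul_le_mul hx ((hb _ _).trans ?_) (abs_nonneg _) hκ
    gcongr
    exact hadd t (_root_.abs_le.2 ⟨ht.1.le, ht.2.le⟩) _ _
  · exact (((((hR.integrable z).add (hR.integrable h)).const_mul K).const_mul C).add
      ((hR.integrable h).const_mul 1)).const_mul κ
  · filter_upwards with x t _
    have h1 : HasDerivAt (fun t : ℝ => rep z x + t • rep h x) (rep h x) t := by
      simpa using ((hasDerivAt_id t).smul_const (rep h x)).const_add (rep z x)
    exact ((he _).comp_hasDerivAt t h1).const_mul (c x)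

/-- A function with a continuous Gateaux derivative is Fréchet differentiable. -/
theorem hasFDerivAt_of_continuousAt_gateaux {E : X → ℝ} {A : X → X →L[ℝ] ℝ} {z : X}
    (hE : ∀ z h : X, HasDerivAt (fun t : ℝ => E (z + t • h)) (A z h) 0) (hA : ContinuousAt A z) :
    HasFDerivAt E (A z) z := by
  rw [hasFDerivAt_iff_isLittleO_nhds_zero, Asymptotics.isLittleO_iff]
  intro ε hε
  obtain ⟨r, hr, hball⟩ := Metric.continuousAt_iff.1 hA ε hε
  filter_upwards [Metric.ball_mem_nhds (0 : X) hr] with h hh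
  rw [mem_ball_zero_iff] at hh
  have hder : ∀ t : ℝ, HasDerivAt (fun t : ℝ => E (z + t • h) - t * A z h)
      (A (z + t • h) h - A z h) t := fun t => by
    have h1 := hE (z + t • h) h
    have h2 : HasDerivAt (fun s : ℝ => s - t) 1 t := by
      simpa using (hasDerivAt_id t).sub_const t
    have h3 := HasDerivAt.scomp_of_eq t h1 h2 (sub_self t).symm
    have h4 : HasDerivAt (fun s : ℝ => E (z + s • h)) (A (z + t • h) h) t := by
      simp only [one_smul] at h3
      refine h3.congr_of_eventuallyEq (Eventually.of_forall fun s => ?_)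
      simp only [Function.comp_apply]
      rw [sub_smul]
      congr 1
      abel
    simpa using h4.fun_sub ((hasDerivAt_id' t).mul_const (A z h))
  have h := Convex.norm_image_sub_le_of_norm_hasDerivWithin_le (s := Icc (0 : ℝ) 1)
    (f := fun t : ℝ => E (z + t • h) - t * A z h) (f' := fun t => A (z + t • h) h - A z h)
    (C := ε * ‖h‖) (x := 0) (y := 1) (fun t _ => (hder t).hasDerivWithinAt) (fun t ht => ?_)
    (convex_Icc 0 1) (by simp) (by simp)
  · simp only [one_smul, one_mul, zero_smul, add_zero, zero_mul, sub_zero, norm_one,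
      mul_one] at h
    rwa [sub_right_comm] at h
  · rw [← sub_apply]
    refine (ContinuousLinearMap.le_opNorm _ _).trans ?_
    gcongr
    rw [← dist_eq_norm]
    refine (hball ?_).le
    rw [dist_eq_norm, add_sub_cancel_left, norm_smul, Real.norm_of_nonneg ht.1]
    exact (mul_le_of_le_one_left (norm_nonneg _) ht.2).trans_lt hh

theorem hasFDerivAt_integral (hΦ : Modular Φ) (hR : Representation μ Φ rep)
    (hc : Weight μ c) (hB : Admissible Φ B) {e : Y → ℝ} (he : ∀ y, HasFDerivAt e (B y) y)
    (he0 : e 0 = 0) (z : X) :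
    HasFDerivAt (fun z => ∫ x, c x * e (rep z x) ∂μ) (pairing hR hc hB z) z :=
  hasFDerivAt_of_continuousAt_gateaux (hasDerivAt_integral_line hΦ hR hc hB he he0)
    (continuousAt_pairing hΦ hR hc hB z)

section PalaisSmale

variable {B' : Y → Y →L[ℝ] ℝ} {c' : α → ℝ} {u : ℕ → X} {u₀ : X} {R : ℝ} {w : ℕ → X →L[ℝ] ℝ}

theorem Representation.tendsto_sub_zero (hR : Representation μ Φ rep)
    (hae : ∀ᵐ x ∂μ, Tendsto (fun n => rep (u n) x) atTop (𝓝 (rep u₀ x))) :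
    ∀ᵐ x ∂μ, Tendsto (fun n => rep (u n - u₀) x) atTop (𝓝 0) := by
  filter_upwards [hae, ae_all_iff.2 fun n => hR.sub (u n) u₀] with x hx hs
  simp_rw [hs]
  simpa using hx.sub_const (rep u₀ x)

theorem norm_sub_le_add (hu : ∀ n, ‖u n‖ ≤ R) (n : ℕ) : ‖u n - u₀‖ ≤ R + ‖u₀‖ :=
  (norm_sub_le _ _).trans (by gcongr; exact hu n)

/-- The almost everywhere limit of a bounded sequence of almost critical points is critical. -/
theorem pairing_add_pairing_eq_zero (hΦ : Modular Φ) (hR : Representation μ Φ rep)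
    (hc : Weight μ c) (hB : Admissible Φ B) (hc' : Weight μ c') (hB' : Admissible Φ B')
    (hu : ∀ n, ‖u n‖ ≤ R)
    (hae : ∀ᵐ x ∂μ, Tendsto (fun n => rep (u n) x) atTop (𝓝 (rep u₀ x)))
    (hw : Tendsto w atTop (𝓝 0))
    (hPS : ∀ n, pairing hR hc hB (u n) + pairing hR hc' hB' (u n) = w n) :
    pairing hR hc hB u₀ + pairing hR hc' hB' u₀ = 0 := by
  have hu' : ∀ n, ‖u n - u₀‖ ≤ R + ‖u₀‖ := norm_sub_le_add hu
  have hae' := hR.tendsto_sub_zero hae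
  have h1 := tendsto_pairing_splitting hΦ hR hc hB hu hae
  have h2 := tendsto_pairing_splitting hΦ hR hc' hB' hu hae
  refine ContinuousLinearMap.ext fun v => ?_
  have e1 := tendsto_pairing_weak_zero hΦ hR hc hB hu' hae' v
  have e2 := tendsto_pairing_weak_zero hΦ hR hc' hB' hu' hae' v
  have e3 := ((ContinuousLinearMap.apply ℝ ℝ v).continuous.tendsto _).comp (h1.add h2)
  have e4 := ((ContinuousLinearMap.apply ℝ ℝ v).continuous.tendsto _).comp hw
  refine tendsto_nhds_unique (tendsto_const_nhds.congr fun n => ?_)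
    (((e3.sub (e1.add e2)).add e4).trans_eq ?_)
  · simp only [Function.comp_apply, ContinuousLinearMap.apply_apply, add_apply, sub_apply, ← hPS]
    ring
  · simp

/-- Almost critical points become, after subtraction of their limit, almost critical for the
functional in which one weight is changed, if the difference of the weights is negligible along the
sequence. -/
theorem tendsto_pairing_add_pairing_sub (hΦ : Modular Φ) (hR : Representation μ Φ rep)
    (hc : Weight μ c) (hB : Admissible Φ B) (hc' : Weight μ c') (hB' : Admissible Φ B')
    {c'' d : α → ℝ} (hc'' : Weight μ c'') (hd : Weight μ d) (hcd : ∀ x, c' x + d x = c'' x)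
    (hu : ∀ n, ‖u n‖ ≤ R)
    (hae : ∀ᵐ x ∂μ, Tendsto (fun n => rep (u n) x) atTop (𝓝 (rep u₀ x)))
    (hw : Tendsto w atTop (𝓝 0))
    (hPS : ∀ n, pairing hR hc hB (u n) + pairing hR hc' hB' (u n) = w n)
    (hneg : Tendsto (fun n => pairing hR hd hB' (u n - u₀)) atTop (𝓝 0)) :
    Tendsto (fun n => pairing hR hc hB (u n - u₀) + pairing hR hc'' hB' (u n - u₀))
      atTop (𝓝 0) := by
  have h := (((tendsto_pairing_splitting hΦ hR hc hB hu hae).add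
    (tendsto_pairing_splitting hΦ hR hc' hB' hu hae)).add hneg).add hw
  simp only [add_zero] at h
  refine h.congr fun n => ?_
  have h0 : pairing hR hc' hB' u₀ = -pairing hR hc hB u₀ := (neg_eq_of_add_eq_zero_right
    (pairing_add_pairing_eq_zero hΦ hR hc hB hc' hB' hu hae hw hPS)).symm
  rw [pairing_add hR hc' hd hc'' hB' hcd, ← hPS n, h0]
  abel

end PalaisSmale

end Abstract

section Elementary

theorem rpow_add_le_two_rpow_mul {r x y : ℝ} (hr : 0 ≤ r) (hx : 0 ≤ x) (hy : 0 ≤ y) :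
    (x + y) ^ r ≤ 2 ^ r * (x ^ r + y ^ r) := by
  have h1 : x + y ≤ 2 * max x y := by linarith [le_max_left x y, le_max_right x y]
  calc (x + y) ^ r ≤ (2 * max x y) ^ r := Real.rpow_le_rpow (by positivity) h1 hr
    _ = 2 ^ r * max x y ^ r := Real.mul_rpow (by norm_num) (le_max_of_le_left hx)
    _ ≤ 2 ^ r * (x ^ r + y ^ r) := by
      gcongr
      rcases le_total x y with h | h
      · rw [max_eq_right h]; linarith [Real.rpow_nonneg hx r]
      · rw [max_eq_left h]; linarith [Real.rpow_nonneg hy r]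

theorem rpow_le_mul_rpow_add {α β ε : ℝ} (hα : 0 < α) (hαβ : α < β) (hε : 0 < ε) :
    ∃ C, 0 ≤ C ∧ ∀ t : ℝ, 0 ≤ t → t ^ α ≤ ε * t ^ β + C := by
  have hγ : 0 < β - α := sub_pos.2 hαβ
  set τ : ℝ := ε⁻¹ ^ (β - α)⁻¹ with hτ
  have hτ0 : 0 < τ := by positivity
  refine ⟨τ ^ α, by positivity, fun t ht => ?_⟩
  rcases le_total t τ with h | h
  · have := Real.rpow_le_rpow ht h hα.le
    have := Real.rpow_nonneg ht β
    nlinarith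
  · have ht' : 0 < t := hτ0.trans_le h
    have h1 : τ ^ (β - α) ≤ t ^ (β - α) := Real.rpow_le_rpow hτ0.le h hγ.le
    rw [hτ, ← Real.rpow_mul (by positivity), inv_mul_cancel₀ hγ.ne', Real.rpow_one] at h1
    have h2 : t ^ β = t ^ α * t ^ (β - α) := by rw [← Real.rpow_add ht']; congr 1; ring
    have h3 : 1 ≤ ε * t ^ (β - α) := by
      calc (1 : ℝ) = ε * ε⁻¹ := by field_simp
        _ ≤ _ := by gcongr
    have h4 : 0 ≤ t ^ α := Real.rpow_nonneg ht _
    have h5 : 0 ≤ τ ^ α := by positivity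
    rw [h2]
    nlinarith

theorem rpow_le_rpow_add_rpow {α β γ t : ℝ} (hα : 0 < α) (h1 : α ≤ γ) (h2 : γ ≤ β) (ht : 0 ≤ t) :
    t ^ γ ≤ t ^ α + t ^ β := by
  have h3 := Real.rpow_nonneg ht α
  have h4 := Real.rpow_nonneg ht β
  rcases ht.eq_or_lt with rfl | ht'
  · rw [Real.zero_rpow (hα.trans_le h1).ne']; positivity
  rcases le_total t 1 with h | h
  · have := Real.rpow_le_rpow_of_exponent_ge ht' h h1
    linarith
  · have := Real.rpow_le_rpow_of_exponent_le h h2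
    linarith

/-- The Young inequality with a parameter. -/
theorem mul_le_mul_rpow_add {q r δ : ℝ} (hqr : q.HolderConjugate r) (hδ : 0 < δ) :
    ∃ C, 0 ≤ C ∧ ∀ x y : ℝ, 0 ≤ x → 0 ≤ y → x * y ≤ δ * x ^ q + C * y ^ r := by
  have hq := hqr.pos
  have hr := hqr.symm.pos
  set c : ℝ := δ ^ q⁻¹ with hc
  have hc0 : 0 < c := by positivity
  refine ⟨c⁻¹ ^ r, by positivity, fun x y hx hy => ?_⟩
  have h := Real.young_inequality_of_nonneg (a := c * x) (b := c⁻¹ * y) (by positivity)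
    (by positivity) hqr
  have h1 : c * x * (c⁻¹ * y) = x * y := by field_simp
  rw [h1, Real.mul_rpow hc0.le hx, Real.mul_rpow (by positivity) hy] at h
  have h2 : c ^ q = δ := by rw [hc, ← Real.rpow_mul hδ.le, inv_mul_cancel₀ hq.ne', Real.rpow_one]
  rw [h2] at h
  have h3 : δ * x ^ q / q ≤ δ * x ^ q := div_le_self (by positivity) hqr.lt.le
  have h4 : c⁻¹ ^ r * y ^ r / r ≤ c⁻¹ ^ r * y ^ r := div_le_self (by positivity) hqr.symm.lt.le
  linarith

end Elementary

section Components

variable {Y E Z S : Type*} [NormedAddCommGroup Y] [NormedSpace ℝ Y]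
  [NormedAddCommGroup E] [NormedSpace ℝ E] [NormedAddCommGroup Z] [InnerProductSpace ℝ Z]
  {Φ : Y → ℝ}

/-- `f a b` is bounded by an arbitrarily small multiple of `Φ a` plus a multiple of `Φ b`. -/
def Negligible (Φ : Y → ℝ) (f : Y → Y → ℝ) : Prop :=
  ∀ ε > 0, ∃ C, 0 ≤ C ∧ ∀ a b, f a b ≤ ε * Φ a + C * Φ b

theorem Negligible.add {f g : Y → Y → ℝ} (hf : Negligible Φ f) (hg : Negligible Φ g) :
    Negligible Φ (fun a b => f a b + g a b) := by
  intro ε hε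
  obtain ⟨C, hC, h⟩ := hf (ε / 2) (by positivity)
  obtain ⟨C', hC', h'⟩ := hg (ε / 2) (by positivity)
  exact ⟨C + C', by positivity, fun a b => by linarith [h a b, h' a b]⟩

theorem Negligible.of_le_mul {f g : Y → Y → ℝ} {K : ℝ} (hΦ : ∀ y, 0 ≤ Φ y) (hg : Negligible Φ g)
    (hK : 0 ≤ K) (h : ∀ a b, f a b ≤ K * g a b) : Negligible Φ f := by
  intro ε hε
  obtain ⟨C, hC, hb⟩ := hg (ε / (K + 1)) (by positivity)
  refine ⟨K * C, by positivity, fun a b => ?_⟩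
  have h1 : K * (ε / (K + 1)) ≤ ε := by
    rw [← mul_div_assoc, div_le_iff₀ (by positivity)]
    nlinarith
  calc f a b ≤ K * (ε / (K + 1) * Φ a + C * Φ b) := (h a b).trans (by gcongr; exact hb a b)
    _ ≤ _ := by nlinarith [mul_le_mul_of_nonneg_right h1 (hΦ a)]

theorem admissible_of_negligible {q r : ℝ} (hqr : q.HolderConjugate r) {F : Y → Z} {T : Y →L[ℝ] Z}
    (hF : Continuous F) (hF0 : F 0 = 0) (hΦ : ∀ y, 0 ≤ Φ y) (hT : ∀ h, ‖T h‖ ^ q ≤ Φ h) {K : ℝ}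
    (hK : 0 ≤ K) (hg : ∀ y, ‖F y‖ ^ r ≤ K * Φ y)
    (hs : Negligible Φ (fun a b => ‖F a - F (a + b) + F b‖ ^ r)) :
    Admissible Φ (fun y => (innerSL ℝ (F y)).comp T) := by
  have hinner : ∀ (z : Z) h, |inner ℝ z (T h)| ≤ ‖z‖ * ‖T h‖ := fun z h =>
    abs_real_inner_le_norm _ _
  refine ⟨?_, by simp [hF0], ?_, ?_, fun a b => ‖F a - F (a + b) + F b‖ ^ r, ?_, ?_, ?_, hs, ?_⟩
  · exact ((innerSL ℝ).continuous.comp hF).clm_comp continuous_const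
  · intro δ hδ
    obtain ⟨C, hC, h⟩ := mul_le_mul_rpow_add hqr.symm (δ := δ / (K + 1)) (by positivity)
    refine ⟨C, hC, fun y k => ?_⟩
    refine (hinner (F y) k).trans ((h _ _ (norm_nonneg _) (norm_nonneg _)).trans ?_)
    have h1 : δ / (K + 1) * ‖F y‖ ^ r ≤ δ * Φ y := by
      calc δ / (K + 1) * ‖F y‖ ^ r ≤ δ / (K + 1) * ((K + 1) * Φ y) := by
            gcongr
            nlinarith [hg y, hΦ y]
        _ = δ * Φ y := by field_simp
    have h2 := mul_le_mul_of_nonneg_left (hT k) hC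
    linarith
  · intro δ hδ
    obtain ⟨C, hC, h⟩ := mul_le_mul_rpow_add hqr hδ
    refine ⟨C * K, by positivity, fun y k => ?_⟩
    refine (hinner (F y) k).trans ?_
    rw [mul_comm]
    refine (h _ _ (norm_nonneg _) (norm_nonneg _)).trans ?_
    have h1 := mul_le_mul_of_nonneg_left (hg y) hC
    have h2 := mul_le_mul_of_nonneg_left (hT k) hδ.le
    linarith
  · refine Continuous.rpow_const ?_ fun _ => Or.inr hqr.symm.pos.le
    fun_prop
  · intro a b
    positivity
  · intro b
    simp [hF0, Real.zero_rpow hqr.symm.pos.ne']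
  · intro δ hδ
    obtain ⟨C, hC, h⟩ := mul_le_mul_rpow_add hqr hδ
    refine ⟨C, hC, fun a b k => ?_⟩
    have h0 := hinner (F a - F (a + b) + F b) k
    rw [inner_add_left, inner_sub_left] at h0
    refine h0.trans ?_
    rw [mul_comm]
    refine (h _ _ (norm_nonneg _) (norm_nonneg _)).trans ?_
    have h2 := mul_le_mul_of_nonneg_left (hT k) hδ.le
    linarith

/-- Uniform smallness of the relative increments of a family of functions of degree `d`. -/
def RelativelyContinuous (d : ℝ) (f : S → E → Z) : Prop :=
  ∀ ε > 0, ∃ δ > 0, ∀ s a b, ‖b‖ ≤ δ * ‖a‖ → ‖f s (a + b) - f s a‖ ≤ ε * ‖a‖ ^ d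

theorem RelativelyContinuous.rpow_le {d r C : ℝ} (hd : 0 < d) (hr : 0 < r) {f : S → E → Z}
    (hf : RelativelyContinuous d f) (hC : 0 ≤ C) (hg : ∀ s ξ, ‖f s ξ‖ ≤ C * ‖ξ‖ ^ d)
    {ε : ℝ} (hε : 0 < ε) :
    ∃ K, 0 ≤ K ∧ ∀ s a b, ‖f s a - f s (a + b)‖ ^ r ≤ ε * (‖a‖ ^ d) ^ r + K * (‖b‖ ^ d) ^ r := by
  obtain ⟨δ, hδ, h⟩ := hf (ε ^ r⁻¹) (by positivity)
  set K : ℝ := C * δ⁻¹ ^ d + C * (δ⁻¹ + 1) ^ d with hKdef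
  have hK : 0 ≤ K := by positivity
  refine ⟨K ^ r, by positivity, fun s a b => ?_⟩
  rcases le_or_gt ‖b‖ (δ * ‖a‖) with hb | hb
  · have h1 := h s a b hb
    rw [norm_sub_rev] at h1
    have h2 := Real.rpow_le_rpow (norm_nonneg _) h1 hr.le
    rw [Real.mul_rpow (by positivity) (by positivity), ← Real.rpow_mul hε.le,
      inv_mul_cancel₀ hr.ne', Real.rpow_one] at h2
    have : 0 ≤ K ^ r * (‖b‖ ^ d) ^ r := by positivity
    linarith
  · have ha : ‖a‖ ≤ δ⁻¹ * ‖b‖ := by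
      rw [← div_eq_inv_mul, le_div_iff₀ hδ]
      linarith
    have h1 : ‖f s a - f s (a + b)‖ ≤ K * ‖b‖ ^ d := by
      calc ‖f s a - f s (a + b)‖ ≤ ‖f s a‖ + ‖f s (a + b)‖ := norm_sub_le _ _
        _ ≤ C * (δ⁻¹ * ‖b‖) ^ d + C * ((δ⁻¹ + 1) * ‖b‖) ^ d := by
          refine add_le_add ((hg _ _).trans ?_) ((hg _ _).trans ?_)
          · gcongr
          · gcongr
            linarith [norm_add_le a b]
        _ = K * ‖b‖ ^ d := by
          rw [Real.mul_rpow (by positivity) (norm_nonneg _),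
            Real.mul_rpow (by positivity) (norm_nonneg _)]
          ring
    have h2 := Real.rpow_le_rpow (norm_nonneg _) h1 hr.le
    rw [Real.mul_rpow hK (by positivity)] at h2
    have : 0 ≤ ε * (‖a‖ ^ d) ^ r := by positivity
    linarith

theorem admissible_of_relativelyContinuous {q r d C : ℝ} (hqr : q.HolderConjugate r) (hd : 0 < d)
    {f : S → E → Z} {sel : Y → S} {π : Y →L[ℝ] E} {T : Y →L[ℝ] Z}
    (hF : Continuous fun y => f (sel y) (π y)) (hΦ : ∀ y, 0 ≤ Φ y) (hT : ∀ h, ‖T h‖ ^ q ≤ Φ h)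
    (hπ : ∀ y, (‖π y‖ ^ d) ^ r ≤ Φ y) (hg : ∀ s ξ, ‖f s ξ‖ ≤ C * ‖ξ‖ ^ d)
    (hf : RelativelyContinuous d f)
    (hsel : Negligible Φ (fun a b => ‖f (sel a) (π a) - f (sel (a + b)) (π a)‖ ^ r)) :
    Admissible Φ (fun y => (innerSL ℝ (f (sel y) (π y))).comp T) := by
  have hr := hqr.symm.pos
  wlog hC : 0 ≤ C generalizing C
  · refine this (C := |C|) (fun s ξ => (hg s ξ).trans ?_) (abs_nonneg _)
    gcongr
    exact le_abs_self C
  have hgr : ∀ y, ‖f (sel y) (π y)‖ ^ r ≤ C ^ r * Φ y := fun y => by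
    refine (Real.rpow_le_rpow (norm_nonneg _) (hg _ _) hr.le).trans ?_
    rw [Real.mul_rpow hC (by positivity)]
    gcongr
    exact hπ y
  refine admissible_of_negligible hqr hF ?_ hΦ hT (K := C ^ r) (by positivity) hgr ?_
  · have := hg (sel 0) (π 0)
    rw [map_zero, norm_zero, Real.zero_rpow hd.ne', mul_zero] at this
    simpa using this
  · have h1 : Negligible Φ fun a b =>
        ‖f (sel (a + b)) (π a) - f (sel (a + b)) (π a + π b)‖ ^ r := by
      intro ε hε
      obtain ⟨K, hK, h⟩ := hf.rpow_le hd hr hC hg hε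
      refine ⟨K, hK, fun a b => (h _ _ _).trans ?_⟩
      gcongr
      · exact hπ a
      · exact hπ b
    have h2 : Negligible Φ fun _ b => ‖f (sel b) (π b)‖ ^ r := fun ε hε =>
      ⟨C ^ r, by positivity, fun a b => (hgr b).trans (by nlinarith [hΦ a])⟩
    refine Negligible.of_le_mul hΦ (K := 2 ^ r * 2 ^ r) ((hsel.add h1).add h2) (by positivity)
      fun a b => ?_
    set x := ‖f (sel a) (π a) - f (sel (a + b)) (π a)‖
    set y := ‖f (sel (a + b)) (π a) - f (sel (a + b)) (π a + π b)‖
    set z := ‖f (sel b) (π b)‖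
    have h3 : ‖f (sel a) (π a) - f (sel (a + b)) (π (a + b)) + f (sel b) (π b)‖ ≤ x + y + z := by
      refine (norm_add_le _ _).trans ?_
      gcongr
      rw [map_add]
      exact norm_sub_le_norm_sub_add_norm_sub _ _ _
    have h4 : (1 : ℝ) ≤ 2 ^ r := Real.one_le_rpow (by norm_num) hr.le
    calc _ ≤ (x + y + z) ^ r := Real.rpow_le_rpow (norm_nonneg _) h3 hr.le
      _ ≤ 2 ^ r * ((x + y) ^ r + z ^ r) :=
        rpow_add_le_two_rpow_mul hr.le (by positivity) (by positivity)
      _ ≤ 2 ^ r * (2 ^ r * (x ^ r + y ^ r) + 2 ^ r * z ^ r) := by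
        gcongr
        · exact rpow_add_le_two_rpow_mul hr.le (by positivity) (by positivity)
        · exact le_mul_of_one_le_left (by positivity) h4
      _ = _ := by ring

theorem negligible_zero (hΦ : ∀ y, 0 ≤ Φ y) {r : ℝ} (hr : 0 < r) :
    Negligible Φ (fun _ _ => ‖(0 : Z)‖ ^ r) := fun ε hε =>
  ⟨0, le_rfl, fun a b => by
    rw [norm_zero, Real.zero_rpow hr.ne']
    linarith [mul_nonneg hε.le (hΦ a)]⟩

theorem relativelyContinuous_of_holder {d K : ℝ} (hd : 0 < d) {f : S → E → Z}
    (h : ∀ s a b, ‖f s (a + b) - f s a‖ ≤ K * ‖b‖ ^ d) : RelativelyContinuous d f := by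
  intro ε hε
  refine ⟨(ε / (|K| + 1)) ^ d⁻¹, by positivity, fun s a b hb => ?_⟩
  calc ‖f s (a + b) - f s a‖ ≤ K * ‖b‖ ^ d := h s a b
    _ ≤ (|K| + 1) * ((ε / (|K| + 1)) ^ d⁻¹ * ‖a‖) ^ d := by
      gcongr
      linarith [le_abs_self K]
    _ = ε * ‖a‖ ^ d := by
      rw [Real.mul_rpow (by positivity) (by positivity), ← Real.rpow_mul (by positivity),
        inv_mul_cancel₀ hd.ne', Real.rpow_one]
      field_simp

theorem relativelyContinuous_of_lipschitz {e K : ℝ} (he : 0 ≤ e) {f : S → E → Z}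
    (h : ∀ s a b, ‖f s (a + b) - f s a‖ ≤ K * (‖a‖ + ‖b‖) ^ e * ‖b‖) :
    RelativelyContinuous (e + 1) f := by
  intro ε hε
  refine ⟨min 1 (ε / ((|K| + 1) * 2 ^ e)), by positivity, fun s a b hb => ?_⟩
  rcases eq_or_ne a 0 with rfl | ha
  · have hb0 : b = 0 := by simpa using hb
    simp [hb0]
    positivity
  have ha' : 0 < ‖a‖ := norm_pos_iff.2 ha
  have h1 : ‖b‖ ≤ ‖a‖ := hb.trans (mul_le_of_le_one_left (norm_nonneg _) (min_le_left _ _))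
  have h2 : ‖b‖ ≤ ε / ((|K| + 1) * 2 ^ e) * ‖a‖ := hb.trans (by gcongr; exact min_le_right _ _)
  calc ‖f s (a + b) - f s a‖ ≤ K * (‖a‖ + ‖b‖) ^ e * ‖b‖ := h s a b
    _ ≤ (|K| + 1) * (2 * ‖a‖) ^ e * (ε / ((|K| + 1) * 2 ^ e) * ‖a‖) := by
      gcongr
      · linarith [le_abs_self K]
      · linarith
    _ = ε * ‖a‖ ^ (e + 1) := by
      rw [Real.mul_rpow (by norm_num) ha'.le, Real.rpow_add_one ha'.ne']
      field_simp

theorem norm_sub_le_of_norm_fderiv_le_rpow {W : Type*} [NormedAddCommGroup W] [NormedSpace ℝ W]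
    {e K : ℝ} (he : 0 ≤ e) {g : E → W} (hg : Differentiable ℝ g)
    (hb : ∀ ξ, ‖fderiv ℝ g ξ‖ ≤ K * ‖ξ‖ ^ e) (a b : E) :
    ‖g (a + b) - g a‖ ≤ |K| * (‖a‖ + ‖b‖) ^ e * ‖b‖ := by
  have h := Convex.norm_image_sub_le_of_norm_fderiv_le (𝕜 := ℝ) (f := g)
    (s := Metric.closedBall (0 : E) (‖a‖ + ‖b‖)) (C := |K| * (‖a‖ + ‖b‖) ^ e) (x := a) (y := a + b)
    (fun x _ => hg x) (fun x hx => ?_) (convex_closedBall _ _)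
    (by simp) (by simpa using norm_add_le a b)
  · simpa using h
  · refine (hb x).trans ?_
    have hx' : ‖x‖ ≤ ‖a‖ + ‖b‖ := by simpa using hx
    gcongr
    exact le_abs_self K

theorem relativelyContinuous_power (p : ℝ) :
    RelativelyContinuous (p - 1) (fun (_ : Unit) (t : ℝ) => |t| ^ (p - 2) * t) := by
  intro ε hε
  have hcont : ContinuousAt (fun t : ℝ => |t| ^ (p - 2) * t) 1 :=
    (continuousAt_id.abs.rpow_const (Or.inl (by simp))).mul continuousAt_id
  obtain ⟨δ, hδ, h⟩ := Metric.continuousAt_iff.1 hcont ε hε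
  refine ⟨δ / 2, by positivity, fun _ a b hb => ?_⟩
  rcases eq_or_ne a 0 with rfl | ha
  · have hb0 : b = 0 := by simpa using hb
    simp [hb0]
    positivity
  have ha' : 0 < |a| := abs_pos.2 ha
  have h1 : dist (1 + b / a) 1 < δ := by
    rw [Real.dist_eq, add_sub_cancel_left, abs_div, div_lt_iff₀ ha']
    rw [Real.norm_eq_abs, Real.norm_eq_abs] at hb
    nlinarith
  have h2 := (h h1).le
  have h3 : a + b = a * (1 + b / a) := by field_simp
  have h4 : |a + b| ^ (p - 2) * (a + b) - |a| ^ (p - 2) * a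
      = |a| ^ (p - 2) * a * (|1 + b / a| ^ (p - 2) * (1 + b / a) - |(1 : ℝ)| ^ (p - 2) * 1) := by
    rw [h3, abs_mul, Real.mul_rpow (abs_nonneg _) (abs_nonneg _)]
    simp
    ring
  have h5 : ‖|a| ^ (p - 2) * a‖ = |a| ^ (p - 1) := by
    rw [norm_mul, Real.norm_eq_abs, Real.norm_eq_abs, abs_of_nonneg (by positivity),
      ← Real.rpow_add_one ha'.ne']
    congr 1
    ring
  simp only [h4]
  rw [norm_mul, h5, mul_comm, Real.norm_eq_abs a]
  gcongr
  rwa [Real.dist_eq] at h2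

end Components

section SobolevModular

variable {E Z : Type*} [NormedAddCommGroup E] [NormedSpace ℝ E]
  [NormedAddCommGroup Z] [InnerProductSpace ℝ Z]

/-- The modular `|s| ^ p + |s| ^ P + |ξ| ^ m + |ξ| ^ p` on `ℝ × E`. -/
def sobolevModular (p P m : ℝ) (y : ℝ × E) : ℝ :=
  |y.1| ^ p + |y.1| ^ P + ‖y.2‖ ^ m + ‖y.2‖ ^ p

theorem sobolevModular_nonneg (p P m : ℝ) (y : ℝ × E) : 0 ≤ sobolevModular p P m y := by
  unfold sobolevModular
  positivity

theorem abs_fst_rpow_le_sobolevModular {p P m σ : ℝ} (hp : 0 < p) (h1 : p ≤ σ) (h2 : σ ≤ P)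
    (y : ℝ × E) : |y.1| ^ σ ≤ sobolevModular p P m y := by
  have := rpow_le_rpow_add_rpow hp h1 h2 (abs_nonneg y.1)
  have h3 : 0 ≤ ‖y.2‖ ^ m + ‖y.2‖ ^ p := by positivity
  unfold sobolevModular
  linarith

theorem norm_snd_rpow_le_sobolevModular {p P m σ : ℝ} (hm : 0 < m) (h1 : m ≤ σ) (h2 : σ ≤ p)
    (y : ℝ × E) : ‖y.2‖ ^ σ ≤ sobolevModular p P m y := by
  have := rpow_le_rpow_add_rpow hm h1 h2 (norm_nonneg y.2)
  have h3 : 0 ≤ |y.1| ^ p + |y.1| ^ P := by positivity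
  unfold sobolevModular
  linarith

theorem modular_sobolevModular {p P m : ℝ} (hp : 0 < p) (hP : 0 < P) (hm : 0 < m) :
    Modular (sobolevModular p P m : ℝ × E → ℝ) := by
  refine ⟨?_, sobolevModular_nonneg p P m, ⟨2 ^ p + 2 ^ P + 2 ^ m, by positivity, fun a b => ?_⟩,
    fun t ht a => ?_, fun y hy => ?_⟩
  · unfold sobolevModular
    exact (((continuous_fst.abs.rpow_const fun _ => Or.inr hp.le).add
      (continuous_fst.abs.rpow_const fun _ => Or.inr hP.le)).add
      (continuous_snd.norm.rpow_const fun _ => Or.inr hm.le)).add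
      (continuous_snd.norm.rpow_const fun _ => Or.inr hp.le)
  · have h1 : ∀ {r : ℝ}, 0 < r → |a.1 + b.1| ^ r ≤ 2 ^ r * (|a.1| ^ r + |b.1| ^ r) := fun hr =>
      (Real.rpow_le_rpow (abs_nonneg _) (abs_add_le _ _) hr.le).trans
        (rpow_add_le_two_rpow_mul hr.le (abs_nonneg _) (abs_nonneg _))
    have h2 : ∀ {r : ℝ}, 0 < r → ‖a.2 + b.2‖ ^ r ≤ 2 ^ r * (‖a.2‖ ^ r + ‖b.2‖ ^ r) := fun hr =>
      (Real.rpow_le_rpow (norm_nonneg _) (norm_add_le _ _) hr.le).trans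
        (rpow_add_le_two_rpow_mul hr.le (norm_nonneg _) (norm_nonneg _))
    set k : ℝ := 2 ^ p + 2 ^ P + 2 ^ m with hk
    have i1 : (2 : ℝ) ^ p ≤ k := by
      have : (0 : ℝ) ≤ 2 ^ P + 2 ^ m := by positivity
      linarith
    have i2 : (2 : ℝ) ^ P ≤ k := by
      have : (0 : ℝ) ≤ 2 ^ p + 2 ^ m := by positivity
      linarith
    have i3 : (2 : ℝ) ^ m ≤ k := by
      have : (0 : ℝ) ≤ 2 ^ p + 2 ^ P := by positivity
      linarith
    have j1 := (h1 hp).trans (mul_le_mul_of_nonneg_right i1 (by positivity))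
    have j2 := (h1 hP).trans (mul_le_mul_of_nonneg_right i2 (by positivity))
    have j3 := (h2 hm).trans (mul_le_mul_of_nonneg_right i3 (by positivity))
    have j4 := (h2 hp).trans (mul_le_mul_of_nonneg_right i1 (by positivity))
    simp only [sobolevModular, Prod.fst_add, Prod.snd_add]
    linarith
  · have h1 : |t * a.1| ≤ |a.1| := by
      rw [abs_mul]
      exact mul_le_of_le_one_left (abs_nonneg _) ht
    have h2 : ‖t • a.2‖ ≤ ‖a.2‖ := by
      rw [norm_smul]
      exact mul_le_of_le_one_left (norm_nonneg _) ht
    simp only [sobolevModular, Prod.smul_fst, Prod.smul_snd, smul_eq_mul]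
    gcongr
  · have key : ∀ g : ℕ → ℝ, (∀ n, 0 ≤ g n) → (∀ n, g n ^ p ≤ sobolevModular p P m (y n)) →
        Tendsto g atTop (𝓝 0) := fun g hg0 hg => by
      have h1 : Tendsto (fun n => g n ^ p) atTop (𝓝 0) :=
        squeeze_zero (fun n => Real.rpow_nonneg (hg0 n) _) hg hy
      have h2 := h1.rpow_const (p := p⁻¹) (Or.inr (by positivity))
      rw [Real.zero_rpow (by positivity)] at h2
      refine h2.congr fun n => ?_
      rw [← Real.rpow_mul (hg0 n), mul_inv_cancel₀ hp.ne', Real.rpow_one]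
    have e1 := key (fun n => |(y n).1|) (fun n => abs_nonneg _) fun n => by
      have : 0 ≤ |(y n).1| ^ P + ‖(y n).2‖ ^ m + ‖(y n).2‖ ^ p := by positivity
      unfold sobolevModular
      linarith
    have e2 := key (fun n => ‖(y n).2‖) (fun n => norm_nonneg _) fun n => by
      have : 0 ≤ |(y n).1| ^ p + |(y n).1| ^ P + ‖(y n).2‖ ^ m := by positivity
      unfold sobolevModular
      linarith
    exact (tendsto_zero_iff_abs_tendsto_zero _ |>.2 e1).prodMk_nhds
      (tendsto_zero_iff_norm_tendsto_zero.2 e2)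

/-- Increments in the first variable of a function which is bounded and Lipschitz in that variable,
with constants of degree `d` in the second variable. -/
theorem negligible_of_lipschitz_fst {p P m d r C : ℝ} (hp : 0 < p) (hm : 0 < m) (hr : 0 < r)
    (h1 : m ≤ d * r) (h2 : d * r < p) {f : ℝ → E → Z} (hg : ∀ s ξ, ‖f s ξ‖ ≤ C * ‖ξ‖ ^ d)
    (hl : ∀ s t ξ, ‖f s ξ - f t ξ‖ ≤ C * |s - t| * ‖ξ‖ ^ d) :
    Negligible (sobolevModular p P m)
      (fun a b : ℝ × E => ‖f a.1 a.2 - f (a.1 + b.1) a.2‖ ^ r) := by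
  wlog hC : 0 ≤ C generalizing C
  · refine this (C := |C|) (fun s ξ => (hg s ξ).trans ?_) (fun s t ξ => (hl s t ξ).trans ?_)
      (abs_nonneg _)
    · gcongr
      exact le_abs_self C
    · gcongr
      exact le_abs_self C
  intro ε hε
  set η : ℝ := ε ^ r⁻¹ / (C + 1) with hη
  have hη0 : 0 < η := by positivity
  obtain ⟨K, hK, hy⟩ := rpow_le_mul_rpow_add (α := d * r) (β := p) (hm.trans_le h1) h2
    (ε := ε / ((2 * C) ^ r + 1)) (by positivity)
  have hdr : ∀ ξ : E, (‖ξ‖ ^ d) ^ r = ‖ξ‖ ^ (d * r) := fun ξ =>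
    (Real.rpow_mul (norm_nonneg _) _ _).symm
  refine ⟨(2 * C) ^ r * K * η⁻¹ ^ p, by positivity, fun a b => ?_⟩
  have hΦb := sobolevModular_nonneg p P m b
  have hΦa := sobolevModular_nonneg p P m a
  rcases le_or_gt |b.1| η with hb | hb
  · have h3 : ‖f a.1 a.2 - f (a.1 + b.1) a.2‖ ≤ ε ^ r⁻¹ * ‖a.2‖ ^ d := by
      refine (hl _ _ _).trans ?_
      gcongr
      rw [sub_add_cancel_left, abs_neg]
      calc C * |b.1| ≤ (C + 1) * η := by gcongr; linarith
        _ = ε ^ r⁻¹ := by rw [hη]; field_simp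
    have h4 := Real.rpow_le_rpow (norm_nonneg _) h3 hr.le
    rw [Real.mul_rpow (by positivity) (by positivity), ← Real.rpow_mul hε.le,
      inv_mul_cancel₀ hr.ne', Real.rpow_one, hdr] at h4
    have h5 := norm_snd_rpow_le_sobolevModular (P := P) hm h1 h2.le a
    have h6 : 0 ≤ (2 * C) ^ r * K * η⁻¹ ^ p * sobolevModular p P m b := by positivity
    have h7 := mul_le_mul_of_nonneg_left h5 hε.le
    linarith
  · have h3 : ‖f a.1 a.2 - f (a.1 + b.1) a.2‖ ≤ 2 * C * ‖a.2‖ ^ d := by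
      refine (norm_sub_le _ _).trans ?_
      linarith [hg a.1 a.2, hg (a.1 + b.1) a.2]
    have h4 := Real.rpow_le_rpow (norm_nonneg _) h3 hr.le
    rw [Real.mul_rpow (by positivity) (by positivity), hdr] at h4
    have h5 := hy ‖a.2‖ (norm_nonneg _)
    have h6 : 1 ≤ η⁻¹ ^ p * |b.1| ^ p := by
      rw [← Real.mul_rpow (by positivity) (abs_nonneg _)]
      refine Real.one_le_rpow ?_ hp.le
      rw [← div_eq_inv_mul, le_div_iff₀ hη0]
      linarith
    have h7 : |b.1| ^ p ≤ sobolevModular p P m b := by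
      have : 0 ≤ |b.1| ^ P + ‖b.2‖ ^ m + ‖b.2‖ ^ p := by positivity
      unfold sobolevModular
      linarith
    have h8 : ‖a.2‖ ^ p ≤ sobolevModular p P m a := by
      have : 0 ≤ |a.1| ^ p + |a.1| ^ P + ‖a.2‖ ^ m := by positivity
      unfold sobolevModular
      linarith
    have h9 : (2 * C) ^ r * (ε / ((2 * C) ^ r + 1)) ≤ ε := by
      rw [← mul_div_assoc, div_le_iff₀ (by positivity)]
      nlinarith [show 0 ≤ (2 * C) ^ r by positivity]
    calc _ ≤ (2 * C) ^ r * (ε / ((2 * C) ^ r + 1) * ‖a.2‖ ^ p + K) :=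
          h4.trans (by gcongr)
      _ = (2 * C) ^ r * (ε / ((2 * C) ^ r + 1)) * ‖a.2‖ ^ p + (2 * C) ^ r * K * 1 := by ring
      _ ≤ ε * sobolevModular p P m a
          + (2 * C) ^ r * K * (η⁻¹ ^ p * sobolevModular p P m b) := by
        gcongr
        exact h6.trans (by gcongr)
      _ = _ := by ring

end SobolevModular

section Regularity

variable {N : ℕ} {p m σ ν C : ℝ} {L : Euc N → ℝ} {M : ℝ → Euc N → ℝ} {G : ℝ → ℝ}

theorem norm_gradient_eq (f : Euc N → ℝ) (ξ : Euc N) : ‖∇ f ξ‖ = ‖fderiv ℝ f ξ‖ := by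
  simp [gradient]

theorem continuous_gradient {f : Euc N → ℝ} (hf : ContDiff ℝ 1 f) : Continuous (∇ f) :=
  (InnerProductSpace.toDual ℝ (Euc N)).symm.continuous.comp (hf.continuous_fderiv one_ne_zero)

theorem differentiable_gradient {f : Euc N → ℝ} (hf : ContDiff ℝ 2 f) :
    Differentiable ℝ (∇ f) :=
  (InnerProductSpace.toDual ℝ (Euc N)).symm.differentiable.comp
    ((hf.fderiv_right (m := 1) (by norm_num)).differentiable one_ne_zero)

theorem AssumptionsL.relativelyContinuous (hL : AssumptionsL p ν C L) (hp : 1 < p) :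
    RelativelyContinuous (p - 1) (fun (_ : Unit) => ∇ L) := by
  rcases le_or_gt p 2 with h | h
  · obtain ⟨K, hK⟩ := hL.sub_holder h
    refine relativelyContinuous_of_holder (K := K) (by linarith) fun _ a b => ?_
    rcases eq_or_ne b 0 with rfl | hb
    · simp [Real.zero_rpow (by linarith : p - 1 ≠ 0)]
    · have := hK a b hb
      rwa [div_le_iff₀ (by positivity)] at this
  · have h1 := relativelyContinuous_of_lipschitz (f := fun (_ : Unit) => ∇ L) (e := p - 2)
      (by linarith) fun _ a b => norm_sub_le_of_norm_fderiv_le_rpow (by linarith)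
        (differentiable_gradient (hL.super_contDiff h)) (hL.super_le h) a b
    rwa [show p - 2 + 1 = p - 1 by ring] at h1

theorem AssumptionsG.relativelyContinuous (hG : AssumptionsG σ C G) (hσ : 1 < σ) :
    RelativelyContinuous (σ - 1) (fun (_ : Unit) t => -deriv G t) := by
  have hneg : ∀ a b : ℝ, ‖-deriv G (a + b) - -deriv G a‖ = |deriv G (a + b) - deriv G a| :=
    fun a b => by rw [neg_sub_neg, Real.norm_eq_abs, abs_sub_comm]
  rcases le_or_gt σ 2 with h | h
  · obtain ⟨K, hK⟩ := hG.sub_holder h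
    refine relativelyContinuous_of_holder (K := K) (by linarith) fun _ a b => ?_
    rw [hneg]
    rcases eq_or_ne b 0 with rfl | hb
    · simp [Real.zero_rpow (by linarith : σ - 1 ≠ 0)]
    · have := hK a b hb
      rwa [div_le_iff₀ (by positivity)] at this
  · have hd : Differentiable ℝ (deriv G) :=
      (contDiff_succ_iff_deriv.1 (by simpa using! hG.super_contDiff h :
        ContDiff ℝ (1 + 1) G)).2.2.differentiable one_ne_zero
    have h1 := relativelyContinuous_of_lipschitz (f := fun (_ : Unit) t => -deriv G t) (e := σ - 2)
      (by linarith) fun _ a b => by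
        have := norm_sub_le_of_norm_fderiv_le_rpow (e := σ - 2) (K := C) (by linarith) hd
          (fun ξ => by rw [← norm_deriv_eq_norm_fderiv]; exact hG.super_le h ξ) a b
        rw [hneg]
        exact this
    rwa [show σ - 2 + 1 = σ - 1 by ring] at h1

theorem AssumptionsM.contDiff_snd (hM : AssumptionsM m ν C M) (s : ℝ) : ContDiff ℝ 1 (M s) :=
  hM.contDiff.comp (contDiff_prodMk_right s)

theorem AssumptionsM.contDiff_partialS_snd (hM : AssumptionsM m ν C M) (s : ℝ) :
    ContDiff ℝ 1 (partialS M s) :=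
  hM.contDiff_partialS.comp (contDiff_prodMk_right s)

theorem AssumptionsM.hasDerivAt_fst (hM : AssumptionsM m ν C M) (s : ℝ) (ξ : Euc N) :
    HasDerivAt (fun t => M t ξ) (partialS M s ξ) s :=
  ((hM.contDiff.comp (contDiff_prodMk_left ξ)).differentiable one_ne_zero s).hasDerivAt

theorem AssumptionsM.hasDerivAt_partialS (hM : AssumptionsM m ν C M) (s : ℝ) (ξ : Euc N) :
    HasDerivAt (fun t => partialS M t ξ) (partialS (partialS M) s ξ) s :=
  ((hM.contDiff_partialS.comp (contDiff_prodMk_left ξ)).differentiable one_ne_zero s).hasDerivAt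

theorem AssumptionsM.hasFDerivAt_uncurry (hM : AssumptionsM m ν C M) (y : ℝ × Euc N) :
    HasFDerivAt (fun z : ℝ × Euc N => M z.1 z.2)
      (fderiv ℝ (fun z : ℝ × Euc N => M z.1 z.2) y) y :=
  (hM.contDiff.differentiable one_ne_zero y).hasFDerivAt

theorem AssumptionsM.hasFDerivAt_snd (hM : AssumptionsM m ν C M) (s : ℝ) (ξ : Euc N) :
    HasFDerivAt (M s) ((fderiv ℝ (fun z : ℝ × Euc N => M z.1 z.2) (s, ξ)).comp
      (ContinuousLinearMap.inr ℝ ℝ (Euc N))) ξ :=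
  HasFDerivAt.comp (g := fun z : ℝ × Euc N => M z.1 z.2) (f := fun η => (s, η)) ξ
    (hM.hasFDerivAt_uncurry (s, ξ)) (hasFDerivAt_prodMk_right s ξ)

theorem AssumptionsM.fderiv_uncurry_apply (hM : AssumptionsM m ν C M) (y h : ℝ × Euc N) :
    fderiv ℝ (fun z : ℝ × Euc N => M z.1 z.2) y h
      = partialS M y.1 y.2 * h.1 + inner ℝ (partialXi M y.1 y.2) h.2 := by
  obtain ⟨s, ξ⟩ := y
  obtain ⟨t, k⟩ := h
  have h2 : fderiv ℝ (M s) ξ k = fderiv ℝ (fun z : ℝ × Euc N => M z.1 z.2) (s, ξ) (0, k) := by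
    rw [(hM.hasFDerivAt_snd s ξ).fderiv]
    simp
  have h3 : HasFDerivAt (fun t => M t ξ) ((fderiv ℝ (fun z : ℝ × Euc N => M z.1 z.2) (s, ξ)).comp
      (ContinuousLinearMap.inl ℝ ℝ (Euc N))) s :=
    HasFDerivAt.comp (g := fun z : ℝ × Euc N => M z.1 z.2) (f := fun t => (t, ξ)) s
      (hM.hasFDerivAt_uncurry (s, ξ)) (hasFDerivAt_prodMk_left s ξ)
  have h4 := h3.hasDerivAt.unique (hM.hasDerivAt_fst s ξ)
  have h5 : ((t, k) : ℝ × Euc N) = t • ((1, 0) : ℝ × Euc N) + (0, k) := by simp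
  rw [h5, map_add, map_smul, ← h2, ← h4]
  simp [partialXi, gradient]
  ring

theorem AssumptionsM.continuous_partialXi (hM : AssumptionsM m ν C M) :
    Continuous fun y : ℝ × Euc N => partialXi M y.1 y.2 := by
  unfold partialXi gradient
  simp_rw [fun y : ℝ × Euc N => (hM.hasFDerivAt_snd y.1 y.2).fderiv]
  exact (InnerProductSpace.toDual ℝ (Euc N)).symm.continuous.comp
    ((hM.contDiff.continuous_fderiv one_ne_zero).clm_comp continuous_const)

theorem AssumptionsM.norm_partialS_add_sub_le (hM : AssumptionsM m ν C M) (hm : 1 < m) (s : ℝ)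
    (a b : Euc N) :
    ‖partialS M s (a + b) - partialS M s a‖ ≤ |C| * (‖a‖ + ‖b‖) ^ (m - 1) * ‖b‖ :=
  norm_sub_le_of_norm_fderiv_le_rpow (by linarith)
    ((hM.contDiff_partialS_snd s).differentiable one_ne_zero)
    (fun ξ => by rw [← norm_gradient_eq]; exact hM.partialSXi_le s ξ) a b

theorem AssumptionsM.relativelyContinuous_partialS (hM : AssumptionsM m ν C M) (hm : 1 < m) :
    RelativelyContinuous m (partialS M) := by
  have h := relativelyContinuous_of_lipschitz (f := partialS M) (e := m - 1) (by linarith)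
    (hM.norm_partialS_add_sub_le hm)
  rwa [sub_add_cancel] at h

theorem AssumptionsM.relativelyContinuous_partialXi (hM : AssumptionsM m ν C M) (hm : 1 < m) :
    RelativelyContinuous (m - 1) (partialXi M) := by
  rcases le_or_gt m 2 with h | h
  · obtain ⟨K, hK⟩ := hM.sub_holder h
    refine relativelyContinuous_of_holder (K := K) (by linarith) fun s a b => ?_
    rcases eq_or_ne b 0 with rfl | hb
    · simp [Real.zero_rpow (by linarith : m - 1 ≠ 0)]
    · have := hK s a b hb
      rwa [div_le_iff₀ (by positivity)] at this
  · have h1 := relativelyContinuous_of_lipschitz (f := partialXi M) (e := m - 2)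
      (by linarith) fun s a b => norm_sub_le_of_norm_fderiv_le_rpow (by linarith)
        (differentiable_gradient ((hM.super_contDiff h).comp (contDiff_prodMk_right s)))
        (hM.super_le h s) a b
    rwa [show m - 2 + 1 = m - 1 by ring] at h1

theorem AssumptionsM.norm_partialS_sub_le (hM : AssumptionsM m ν C M) (s t : ℝ) (ξ : Euc N) :
    ‖partialS M s ξ - partialS M t ξ‖ ≤ C * |s - t| * ‖ξ‖ ^ m := by
  have h := Convex.norm_image_sub_le_of_norm_hasDerivWithin_le (s := univ)
    (f := fun t => partialS M t ξ) (C := C * ‖ξ‖ ^ m) (x := t) (y := s)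
    (fun x _ => (hM.hasDerivAt_partialS x ξ).hasDerivWithinAt)
    (fun x _ => hM.partialSS_le x ξ) convex_univ (mem_univ _) (mem_univ _)
  rw [Real.norm_eq_abs (s - t)] at h
  linarith

theorem AssumptionsM.sub_sub_le (hM : AssumptionsM m ν C M) (hm : 1 < m) (s t : ℝ)
    (a b : Euc N) :
    ‖(M s (a + b) - M t (a + b)) - (M s a - M t a)‖
      ≤ |C| * (‖a‖ + ‖b‖) ^ (m - 1) * ‖b‖ * |s - t| := by
  have h := Convex.norm_image_sub_le_of_norm_hasDerivWithin_le (s := univ)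
    (f := fun t => M t (a + b) - M t a) (x := t) (y := s)
    (fun x _ => ((hM.hasDerivAt_fst x (a + b)).sub (hM.hasDerivAt_fst x a)).hasDerivWithinAt)
    (fun x _ => hM.norm_partialS_add_sub_le hm x a b) convex_univ (mem_univ _) (mem_univ _)
  rw [Real.norm_eq_abs (s - t)] at h
  rwa [sub_sub_sub_comm]

theorem AssumptionsM.norm_partialXi_sub_le (hM : AssumptionsM m ν C M) (hm : 1 < m) (s t : ℝ)
    (ξ : Euc N) :
    ‖partialXi M s ξ - partialXi M t ξ‖ ≤ |C| * 2 ^ (m - 1) * |s - t| * ‖ξ‖ ^ (m - 1) := by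
  rcases eq_or_ne ξ 0 with rfl | hξ
  · have h0 : ∀ s, partialXi M s 0 = 0 := fun s => by
      simpa [Real.zero_rpow (by linarith : m - 1 ≠ 0)] using hM.partialXi_le s 0
    rw [h0, h0, sub_self, norm_zero]
    positivity
  have hξ' : 0 < ‖ξ‖ := norm_pos_iff.2 hξ
  have hd : ∀ s, DifferentiableAt ℝ (M s) ξ := fun s =>
    (hM.contDiff_snd s).differentiable one_ne_zero ξ
  have h1 : partialXi M s ξ - partialXi M t ξ = ∇ (fun η => M s η - M t η) ξ := by
    unfold partialXi gradient
    rw [fderiv_fun_sub (hd s) (hd t), map_sub]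
  rw [h1, norm_gradient_eq]
  refine norm_fderiv_le_of_lip' ℝ (by positivity) ?_
  filter_upwards [Metric.ball_mem_nhds ξ hξ'] with x hx
  rw [mem_ball_iff_norm] at hx
  have h2 := hM.sub_sub_le hm s t ξ (x - ξ)
  rw [add_sub_cancel] at h2
  refine h2.trans ?_
  calc |C| * (‖ξ‖ + ‖x - ξ‖) ^ (m - 1) * ‖x - ξ‖ * |s - t|
      ≤ |C| * (2 * ‖ξ‖) ^ (m - 1) * ‖x - ξ‖ * |s - t| := by
        gcongr
        · linarith
    _ = _ := by
      rw [Real.mul_rpow (by norm_num) (norm_nonneg _)]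
      ring

end Regularity

section AdmissibleFields

variable {N : ℕ} {p P m σ ν C : ℝ} {L : Euc N → ℝ} {M : ℝ → Euc N → ℝ} {G : ℝ → ℝ}

/-- The linear form `h ↦ j_ξ(y) · h.2`. -/
def formXi (L : Euc N → ℝ) (M : ℝ → Euc N → ℝ) (y : ℝ × Euc N) : ℝ × Euc N →L[ℝ] ℝ :=
  (innerSL ℝ (∇ L y.2)).comp (ContinuousLinearMap.snd ℝ ℝ (Euc N)) +
    (innerSL ℝ (partialXi M y.1 y.2)).comp (ContinuousLinearMap.snd ℝ ℝ (Euc N))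

/-- The linear form `h ↦ j_s(y) h.1`. -/
def formS (M : ℝ → Euc N → ℝ) (G : ℝ → ℝ) (y : ℝ × Euc N) : ℝ × Euc N →L[ℝ] ℝ :=
  (innerSL ℝ (partialS M y.1 y.2)).comp (ContinuousLinearMap.fst ℝ ℝ (Euc N)) +
    (innerSL ℝ (-deriv G y.1)).comp (ContinuousLinearMap.fst ℝ ℝ (Euc N))

/-- The linear form `h ↦ |y.1| ^ (p - 2) * y.1 * h.1`. -/
def formPower (p : ℝ) (y : ℝ × Euc N) : ℝ × Euc N →L[ℝ] ℝ :=
  (innerSL ℝ (|y.1| ^ (p - 2) * y.1)).comp (ContinuousLinearMap.fst ℝ ℝ (Euc N))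

theorem rpow_rpow_conj {q r : ℝ} (hqr : q.HolderConjugate r) {t : ℝ} (ht : 0 ≤ t) :
    (t ^ (q - 1)) ^ r = t ^ q := by
  rw [← Real.rpow_mul ht, hqr.sub_one_mul_conj]

theorem abs_power_eq {p : ℝ} (hp : 1 < p) (t : ℝ) : |(|t| ^ (p - 2) * t)| = |t| ^ (p - 1) := by
  rcases eq_or_ne t 0 with rfl | ht
  · simp [Real.zero_rpow (by linarith : p - 1 ≠ 0)]
  · rw [abs_mul, abs_of_nonneg (by positivity), ← Real.rpow_add_one (abs_pos.2 ht).ne']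
    congr 1
    ring

theorem admissible_formXi (hL : AssumptionsL p ν C L) (hM : AssumptionsM m ν C M) (hm : 1 < m)
    (hmp : m < p) : Admissible (sobolevModular p P m) (formXi L M) := by
  have hΦ := sobolevModular_nonneg (E := Euc N) p P m
  have hp : 1 < p := hm.trans hmp
  have hqp := Real.HolderConjugate.conjExponent hp
  have hqm := Real.HolderConjugate.conjExponent hm
  refine Admissible.add ?_ ?_
  · refine admissible_of_relativelyContinuous (d := p - 1) (C := C) hqp (by linarith)
      (f := fun (_ : Unit) => ∇ L) (sel := fun _ => ())
      (π := ContinuousLinearMap.snd ℝ ℝ (Euc N))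
      ((continuous_gradient hL.contDiff).comp continuous_snd) hΦ
      (fun h => norm_snd_rpow_le_sobolevModular (by linarith) hmp.le le_rfl h) (fun y => ?_)
      (fun _ => hL.grad_le) (hL.relativelyContinuous hp) ?_
    · rw [rpow_rpow_conj hqp (norm_nonneg _)]
      exact norm_snd_rpow_le_sobolevModular (by linarith) hmp.le le_rfl y
    · simp only [sub_self]
      exact negligible_zero hΦ hqp.symm.pos
  · refine admissible_of_relativelyContinuous (d := m - 1) (C := C) hqm (by linarith)
      (f := partialXi M) (sel := Prod.fst) (π := ContinuousLinearMap.snd ℝ ℝ (Euc N))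
      hM.continuous_partialXi hΦ
      (fun h => norm_snd_rpow_le_sobolevModular (by linarith) le_rfl hmp.le h) (fun y => ?_)
      hM.partialXi_le (hM.relativelyContinuous_partialXi hm) ?_
    · rw [rpow_rpow_conj hqm (norm_nonneg _)]
      exact norm_snd_rpow_le_sobolevModular (by linarith) le_rfl hmp.le y
    · refine negligible_of_lipschitz_fst (d := m - 1) (C := |C| * 2 ^ (m - 1)) (by linarith)
        (by linarith) hqm.symm.pos hqm.sub_one_mul_conj.ge (by rwa [hqm.sub_one_mul_conj])
        (fun s ξ => (hM.partialXi_le s ξ).trans ?_) (hM.norm_partialXi_sub_le hm)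
      gcongr
      calc C ≤ |C| * 1 := by rw [mul_one]; exact le_abs_self C
        _ ≤ |C| * 2 ^ (m - 1) := by
          gcongr
          exact Real.one_le_rpow (by norm_num) (by linarith)

theorem admissible_formS (hM : AssumptionsM m ν C M) (hG : AssumptionsG σ C G) (hm : 1 < m)
    (hmp : m < p) (hpσ : p < σ) (hσP : σ < P) (hmP : m * P.conjExponent < p) :
    Admissible (sobolevModular p P m) (formS M G) := by
  have hΦ := sobolevModular_nonneg (E := Euc N) p P m
  have hqP := Real.HolderConjugate.conjExponent (by linarith : 1 < P)
  have hqσ := Real.HolderConjugate.conjExponent (by linarith : 1 < σ)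
  have hmP' : m ≤ m * P.conjExponent := le_mul_of_one_le_right (by linarith) hqP.symm.lt.le
  refine Admissible.add ?_ ?_
  · refine admissible_of_relativelyContinuous (d := m) (C := C) hqP (by linarith)
      (f := partialS M) (sel := Prod.fst) (π := ContinuousLinearMap.snd ℝ ℝ (Euc N))
      hM.contDiff_partialS.continuous hΦ
      (fun h => abs_fst_rpow_le_sobolevModular (by linarith) (by linarith) le_rfl h) (fun y => ?_)
      hM.partialS_le (hM.relativelyContinuous_partialS hm) ?_
    · rw [← Real.rpow_mul (norm_nonneg _)]
      exact norm_snd_rpow_le_sobolevModular (by linarith) hmP' hmP.le y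
    · exact negligible_of_lipschitz_fst (by linarith) (by linarith) hqP.symm.pos hmP' hmP
        hM.partialS_le hM.norm_partialS_sub_le
  · refine admissible_of_relativelyContinuous (d := σ - 1) (C := C) hqσ (by linarith)
      (f := fun (_ : Unit) t => -deriv G t) (sel := fun _ => ())
      (π := ContinuousLinearMap.fst ℝ ℝ (Euc N))
      ((hG.contDiff.continuous_deriv le_rfl).neg.comp continuous_fst) hΦ
      (fun h => abs_fst_rpow_le_sobolevModular (by linarith) hpσ.le hσP.le h) (fun y => ?_)
      (fun _ t => by rw [norm_neg]; exact hG.deriv_le t)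
      (hG.relativelyContinuous (by linarith)) ?_
    · rw [rpow_rpow_conj hqσ (norm_nonneg _)]
      exact abs_fst_rpow_le_sobolevModular (by linarith) hpσ.le hσP.le y
    · simp only [sub_self]
      exact negligible_zero hΦ hqσ.symm.pos

theorem admissible_formPower (hp : 1 < p) (hpP : p ≤ P) :
    Admissible (sobolevModular p P m : ℝ × Euc N → ℝ) (formPower p) := by
  have hΦ := sobolevModular_nonneg (E := Euc N) p P m
  have hqp := Real.HolderConjugate.conjExponent hp
  refine admissible_of_relativelyContinuous (d := p - 1) (C := 1) hqp (by linarith)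
    (f := fun (_ : Unit) t => |t| ^ (p - 2) * t) (sel := fun _ => ())
    (π := ContinuousLinearMap.fst ℝ ℝ (Euc N)) ?_ hΦ
    (fun h => abs_fst_rpow_le_sobolevModular (by linarith) le_rfl hpP h) (fun y => ?_)
    (fun _ t => by rw [one_mul]; exact (abs_power_eq hp t).le) (relativelyContinuous_power p) ?_
  · have h1 : Continuous fun t : ℝ => |t| ^ (p - 2) * t := by
      have h2 : (fun t : ℝ => |t| ^ (p - 2) * t) = fun t => p⁻¹ * deriv (fun t : ℝ => |t| ^ p) t := by
        funext t
        rw [(hasDerivAt_abs_rpow t hp).deriv]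
        field_simp
      rw [h2]
      exact continuous_const.mul ((contDiff_norm_rpow hp).continuous_deriv le_rfl)
    exact h1.comp continuous_fst
  · rw [rpow_rpow_conj hqp (norm_nonneg _)]
    exact abs_fst_rpow_le_sobolevModular (by linarith) le_rfl hpP y
  · simp only [sub_self]
    exact negligible_zero hΦ hqp.symm.pos

theorem abs_formPower_le (hp : 1 < p) (hpP : p ≤ P) {δ : ℝ} (hδ : 0 < δ) :
    ∃ K, 0 ≤ K ∧ ∀ y h : ℝ × Euc N,
      |formPower p y h| ≤ K * |y.1| ^ p + δ * sobolevModular p P m h := by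
  have hqp := Real.HolderConjugate.conjExponent hp
  obtain ⟨K, hK, hb⟩ := mul_le_mul_rpow_add hqp hδ
  refine ⟨K, hK, fun y h => ?_⟩
  have h1 := hb |h.1| (|y.1| ^ (p - 1)) (abs_nonneg _) (by positivity)
  rw [rpow_rpow_conj hqp (abs_nonneg _)] at h1
  have h2 := mul_le_mul_of_nonneg_left
    (abs_fst_rpow_le_sobolevModular (m := m) (by linarith) le_rfl hpP h) hδ.le
  have h3 : |formPower p y h| = |h.1| * |y.1| ^ (p - 1) := by
    simp only [formPower, ContinuousLinearMap.comp_apply, innerSL_apply_apply,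
      ContinuousLinearMap.coe_fst', RCLike.inner_apply, conj_trivial, abs_mul]
    rw [← abs_mul, ← abs_power_eq hp, abs_mul]
  rw [h3]
  linarith

theorem hasFDerivAt_abs_rpow_fst (hp : 1 < p) (y : ℝ × Euc N) :
    HasFDerivAt (fun y : ℝ × Euc N => |y.1| ^ p / p) (formPower p y) y := by
  have h := ((hasDerivAt_abs_rpow y.1 hp).div_const p).comp_hasFDerivAt y
    (hasFDerivAt_fst (𝕜 := ℝ) (p := y))
  refine h.congr_fderiv ?_
  ext h
  · simp [formPower]
    field_simp
  · simp [formPower]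

theorem jS_eq (hM : AssumptionsM m ν C M) (hG : AssumptionsG σ C G) (s : ℝ) (ξ : Euc N) :
    jS L M G s ξ = partialS M s ξ - deriv G s :=
  (((hM.hasDerivAt_fst s ξ).const_add (L ξ)).sub
    (hG.contDiff.differentiable one_ne_zero s).hasDerivAt).deriv

theorem jXi_eq (hL : AssumptionsL p ν C L) (hM : AssumptionsM m ν C M) (s : ℝ) (ξ : Euc N) :
    jXi L M G s ξ = ∇ L ξ + partialXi M s ξ := by
  unfold jXi partialXi gradient j
  rw [fderiv_sub_const, fderiv_fun_add (hL.contDiff.differentiable one_ne_zero ξ)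
    ((hM.contDiff_snd s).differentiable one_ne_zero ξ), map_add]

theorem formXi_apply (hL : AssumptionsL p ν C L) (hM : AssumptionsM m ν C M) (y h : ℝ × Euc N) :
    formXi L M y h = inner ℝ (jXi L M G y.1 y.2) h.2 := by
  rw [jXi_eq hL hM, inner_add_left]
  rfl

theorem formS_apply (hM : AssumptionsM m ν C M) (hG : AssumptionsG σ C G) (y h : ℝ × Euc N) :
    formS M G y h = jS L M G y.1 y.2 * h.1 := by
  rw [jS_eq hM hG]
  simp [formS]
  ring

theorem formPower_apply (y h : ℝ × Euc N) :
    formPower p y h = |y.1| ^ (p - 2) * y.1 * h.1 := by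
  simp [formPower]
  ring

theorem hasFDerivAt_j (hL : AssumptionsL p ν C L) (hM : AssumptionsM m ν C M)
    (hG : AssumptionsG σ C G) (y : ℝ × Euc N) :
    HasFDerivAt (fun y : ℝ × Euc N => j L M G y.1 y.2) (formXi L M y + formS M G y) y := by
  have h1 := ((hL.contDiff.differentiable one_ne_zero y.2).hasFDerivAt.comp y
    hasFDerivAt_snd).add (hM.hasFDerivAt_uncurry y) |>.sub
      (((hG.contDiff.differentiable one_ne_zero y.1).hasDerivAt).comp_hasFDerivAt y hasFDerivAt_fst)
  refine h1.congr_fderiv ?_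
  refine ContinuousLinearMap.ext fun h => ?_
  simp [formXi, formS, hM.fderiv_uncurry_apply, gradient]
  ring

theorem j_zero (hL : AssumptionsL p ν C L) (hM : AssumptionsM m ν C M) (hG : AssumptionsG σ C G)
    (hp : p ≠ 0) (hm : m ≠ 0) : j L M G 0 0 = 0 := by
  have h1 : L 0 = 0 := by simpa [Real.zero_rpow hp] using hL.upper 0
  have h2 : M 0 0 = 0 := le_antisymm (by simpa [Real.zero_rpow hm] using hM.upper 0 0)
    (by simpa [Real.zero_rpow hm] using hM.lower 0 0)
  simp [j, h1, h2, hG.map_zero]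

end AdmissibleFields

theorem integrable_norm_rpow_of_eLpNorm_le {α E : Type*} [MeasurableSpace α] {μ : Measure α}
    [NormedAddCommGroup E] {f : α → E} {q c : ℝ} (hq : 0 < q) (hc : 0 ≤ c)
    (hf : AEStronglyMeasurable f μ) (h : eLpNorm f (ENNReal.ofReal q) μ ≤ ENNReal.ofReal c) :
    Integrable (fun x => ‖f x‖ ^ q) μ ∧ ∫ x, ‖f x‖ ^ q ∂μ ≤ c ^ q := by
  have hmem : MemLp f (ENNReal.ofReal q) μ := ⟨hf, h.trans_lt ENNReal.ofReal_lt_top⟩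
  have hq0 : ENNReal.ofReal q ≠ 0 := by simpa using hq
  have hqr : (ENNReal.ofReal q).toReal = q := ENNReal.toReal_ofReal hq.le
  have h1 := hmem.integrable_norm_rpow hq0 ENNReal.ofReal_ne_top
  rw [hqr] at h1
  refine ⟨h1, ?_⟩
  rw [hmem.eLpNorm_eq_integral_rpow_norm hq0 ENNReal.ofReal_ne_top, hqr,
    ENNReal.ofReal_le_ofReal_iff hc] at h
  rwa [Real.rpow_inv_le_iff_of_pos (integral_nonneg fun x => by positivity) hc hq] at h

section SobolevSpace

variable {N : ℕ} {p m : ℝ} [Fact (1 ≤ ENNReal.ofReal p)] [Fact (1 ≤ ENNReal.ofReal m)]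
  {Ω : TopologicalSpace.Opens (Euc N)}

theorem norm_fst_fst_le (w : Triple N p m) : ‖w.fst.fst‖ ≤ ‖w‖ :=
  (WithLp.norm_fst_le _ w.fst).trans (WithLp.norm_fst_le _ w)

theorem norm_fst_snd_le (w : Triple N p m) : ‖w.fst.snd‖ ≤ ‖w‖ :=
  (WithLp.norm_snd_le _ w.fst).trans (WithLp.norm_fst_le _ w)

theorem norm_snd_le (w : Triple N p m) : ‖w.snd‖ ≤ ‖w‖ :=
  WithLp.norm_snd_le _ w

theorem tendsto_fst_fst {w : ℕ → Triple N p m} {w₀ : Triple N p m}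
    (h : Tendsto w atTop (𝓝 w₀)) : Tendsto (fun n => (w n).fst.fst) atTop (𝓝 w₀.fst.fst) := by
  rw [tendsto_iff_norm_sub_tendsto_zero] at h ⊢
  exact squeeze_zero (fun _ => norm_nonneg _) (fun n => norm_fst_fst_le (w n - w₀)) h

theorem tendsto_fst_snd {w : ℕ → Triple N p m} {w₀ : Triple N p m}
    (h : Tendsto w atTop (𝓝 w₀)) : Tendsto (fun n => (w n).fst.snd) atTop (𝓝 w₀.fst.snd) := by
  rw [tendsto_iff_norm_sub_tendsto_zero] at h ⊢
  exact squeeze_zero (fun _ => norm_nonneg _) (fun n => norm_fst_snd_le (w n - w₀)) h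

theorem tendsto_snd {w : ℕ → Triple N p m} {w₀ : Triple N p m}
    (h : Tendsto w atTop (𝓝 w₀)) : Tendsto (fun n => (w n).snd) atTop (𝓝 w₀.snd) := by
  rw [tendsto_iff_norm_sub_tendsto_zero] at h ⊢
  exact squeeze_zero (fun _ => norm_nonneg _) (fun n => norm_snd_le (w n - w₀)) h

/-- Elements of the Sobolev space are limits, in norm and almost everywhere, of test functions. -/
theorem exists_seq_test_tendsto (w : sobolevZero p m Ω) :
    ∃ (z : ℕ → Triple N p m) (f : ℕ → 𝓓(Ω, ℝ)), (∀ n, Represents (z n) (f n)) ∧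
      Tendsto z atTop (𝓝 (w : Triple N p m)) ∧
      (∀ᵐ x, Tendsto (fun n => f n x) atTop (𝓝 (val (w : Triple N p m) x))) ∧
      (∀ᵐ x, Tendsto (fun n => ∇ (f n) x) atTop (𝓝 (grad (w : Triple N p m) x))) ∧
      ∀ᵐ x, Tendsto (fun n => ∇ (f n) x) atTop (𝓝 ((w : Triple N p m).snd x)) := by
  obtain ⟨z, hz, hlim⟩ := mem_closure_iff_seq_limit.1 w.2
  choose f hf using hz
  obtain ⟨a, ha, h1⟩ :=
    (tendstoInMeasure_of_tendsto_Lp (tendsto_fst_fst hlim)).exists_seq_tendsto_ae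
  have hlim1 := hlim.comp ha.tendsto_atTop
  obtain ⟨b, hb, h2⟩ :=
    (tendstoInMeasure_of_tendsto_Lp (tendsto_fst_snd hlim1)).exists_seq_tendsto_ae
  have hlim2 := hlim1.comp hb.tendsto_atTop
  obtain ⟨c, hc, h3⟩ := (tendstoInMeasure_of_tendsto_Lp (tendsto_snd hlim2)).exists_seq_tendsto_ae
  refine ⟨fun n => z (a (b (c n))), fun n => f (a (b (c n))), fun n => hf _,
    hlim2.comp hc.tendsto_atTop, ?_, ?_, ?_⟩
  · filter_upwards [h1, ae_all_iff.2 fun n => (hf n).1] with x hx he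
    refine ((hx.comp hb.tendsto_atTop).comp hc.tendsto_atTop).congr fun n => ?_
    exact he _
  · filter_upwards [h2, ae_all_iff.2 fun n => (hf n).2.1] with x hx he
    refine (hx.comp hc.tendsto_atTop).congr fun n => ?_
    exact he _
  · filter_upwards [h3, ae_all_iff.2 fun n => (hf n).2.2] with x hx he
    exact hx.congr fun n => he _

theorem snd_ae_eq_grad (w : sobolevZero p m Ω) :
    ((w : Triple N p m).snd : Euc N → Euc N) =ᵐ[volume] grad (w : Triple N p m) := by
  obtain ⟨z, f, -, -, -, h1, h2⟩ := exists_seq_test_tendsto w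
  filter_upwards [h1, h2] with x h1 h2 using tendsto_nhds_unique h2 h1

theorem val_grad_ae_eq_zero (w : sobolevZero p m Ω) :
    ∀ᵐ x, x ∉ Ω → val (w : Triple N p m) x = 0 ∧ grad (w : Triple N p m) x = 0 := by
  obtain ⟨z, f, -, -, h1, h2, -⟩ := exists_seq_test_tendsto w
  filter_upwards [h1, h2] with x h1 h2 hx
  have hx' : ∀ n, x ∉ tsupport (f n) := fun n h => hx ((f n).tsupport_subset h)
  have e1 : ∀ n, f n x = 0 := fun n => image_eq_zero_of_notMem_tsupport (hx' n)
  have e2 : ∀ n, ∇ (f n) x = 0 := fun n => by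
    have : fderiv ℝ (f n) x = 0 :=
      image_eq_zero_of_notMem_tsupport fun h => hx' n (tsupport_fderiv_subset ℝ h)
    simp [gradient, this]
  simp only [e1] at h1
  simp only [e2] at h2
  exact ⟨tendsto_nhds_unique h1 tendsto_const_nhds, tendsto_nhds_unique h2 tendsto_const_nhds⟩

/-- The Sobolev inequality on the completion of the test functions. -/
theorem exists_eLpNorm_val_le (hp : 1 < p) (hpN : p < N) :
    ∃ K : ℝ, 0 ≤ K ∧ ∀ w : sobolevZero p m Ω,
      eLpNorm (val (w : Triple N p m)) (ENNReal.ofReal (N * p / (N - p))) volume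
        ≤ ENNReal.ofReal (K * ‖w‖) := by
  have hN : 0 < (N : ℝ) := by linarith
  have hpN' : 0 < (N : ℝ) - p := by linarith
  set K : NNReal := SNormLESNormFDerivOfEqConst ℝ (volume : Measure (Euc N)) p.toNNReal
  refine ⟨K, K.coe_nonneg, fun w => ?_⟩
  have htest : ∀ (f : 𝓓(Ω, ℝ)) (z : Triple N p m), Represents z f →
      eLpNorm f (ENNReal.ofReal (N * p / (N - p))) volume ≤ ENNReal.ofReal (K * ‖z‖) := by
    intro f z hz
    have h1 := eLpNorm_le_eLpNorm_fderiv_of_eq (volume : Measure (Euc N)) (u := f)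
      (f.contDiff.of_le (by simp)) f.hasCompactSupport (p := p.toNNReal)
      (p' := (N * p / (N - p)).toNNReal) (by simpa using hp.le)
      (by simpa using hN) (by
        have hP : (0 : ℝ) ≤ N * p / (N - p) := by positivity
        rw [NNReal.coe_inv, Real.coe_toNNReal p (by linarith), Real.coe_toNNReal _ hP]
        simp
        field_simp)
    refine h1.trans ?_
    rw [ENNReal.ofReal_mul K.coe_nonneg, ENNReal.ofReal_coe_nnreal]
    gcongr
    have h2 : eLpNorm (fderiv ℝ f) (p.toNNReal : ℝ≥0∞) volume
        = eLpNorm z.fst.snd (ENNReal.ofReal p) volume := by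
      refine eLpNorm_congr_norm_ae ?_
      filter_upwards [hz.2.1] with x hx
      rw [hx, norm_gradient_eq]
    rw [h2, ← Lp.enorm_def, ← ofReal_norm]
    exact ENNReal.ofReal_le_ofReal (norm_fst_snd_le z)
  obtain ⟨z, f, hz, hlim, h1, -, -⟩ := exists_seq_test_tendsto w
  refine ENNReal.le_of_forall_pos_le_add fun ε hε _ => ?_
  refine Lp.eLpNorm_le_of_ae_tendsto ?_ (fun n => (f n).aestronglyMeasurable) h1
  have h2 : Tendsto (fun n => ENNReal.ofReal (K * ‖z n‖)) atTop
      (𝓝 (ENNReal.ofReal (K * ‖w‖))) := ENNReal.tendsto_ofReal (hlim.norm.const_mul _)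
  have h3 := h2.eventually_lt_const
    (ENNReal.lt_add_right ENNReal.ofReal_ne_top (by simpa using hε.ne' : (ε : ℝ≥0∞) ≠ 0))
  filter_upwards [h3] with n hn
  exact (htest _ _ (hz n)).trans hn.le

/-- The pair formed by a function of the Sobolev space and its gradient. -/
def valGrad (w : sobolevZero p m Ω) (x : Euc N) : ℝ × Euc N :=
  (val (w : Triple N p m) x, grad (w : Triple N p m) x)

theorem exists_integral_sobolevModular_le (hm : 1 < m) (hp : 1 < p) (hpN : p < N) :
    ∃ K : ℝ, 0 ≤ K ∧ ∀ w : sobolevZero p m Ω,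
      Integrable (fun x => sobolevModular p (N * p / (N - p)) m (valGrad w x)) volume ∧
      ∫ x, sobolevModular p (N * p / (N - p)) m (valGrad w x)
        ≤ ‖w‖ ^ p + (K * ‖w‖) ^ (N * p / (N - p)) + ‖w‖ ^ m + ‖w‖ ^ p := by
  obtain ⟨K, hK, hS⟩ := exists_eLpNorm_val_le (m := m) (Ω := Ω) hp hpN
  have hpN' : 0 < (N : ℝ) - p := by linarith
  have hP : 0 < N * p / (N - p) := div_pos (mul_pos (by linarith) (by linarith)) hpN'
  refine ⟨K, hK, fun w => ?_⟩
  have hLp : ∀ {E : Type} [NormedAddCommGroup E] {q : ℝ} [Fact (1 ≤ ENNReal.ofReal q)]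
      (f : Lp E (ENNReal.ofReal q) (volume : Measure (Euc N))), ‖f‖ ≤ ‖w‖ →
      eLpNorm f (ENNReal.ofReal q) volume ≤ ENNReal.ofReal ‖w‖ := fun f hf => by
    rw [← Lp.enorm_def, ← ofReal_norm]
    exact ENNReal.ofReal_le_ofReal hf
  obtain ⟨i1, b1⟩ := integrable_norm_rpow_of_eLpNorm_le (q := p) (by linarith) (norm_nonneg w)
    (Lp.aestronglyMeasurable (w : Triple N p m).fst.fst)
    (hLp _ (norm_fst_fst_le (w : Triple N p m)))
  obtain ⟨i2, b2⟩ := integrable_norm_rpow_of_eLpNorm_le hP (by positivity)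
    (Lp.aestronglyMeasurable (w : Triple N p m).fst.fst) (hS w)
  obtain ⟨i3, b3⟩ := integrable_norm_rpow_of_eLpNorm_le (q := m) (by linarith) (norm_nonneg w)
    (Lp.aestronglyMeasurable (w : Triple N p m).fst.snd)
    ((eLpNorm_congr_ae (snd_ae_eq_grad w).symm).trans_le
      (hLp _ (norm_snd_le (w : Triple N p m))))
  obtain ⟨i4, b4⟩ := integrable_norm_rpow_of_eLpNorm_le (q := p) (by linarith) (norm_nonneg w)
    (Lp.aestronglyMeasurable (w : Triple N p m).fst.snd)
    (hLp _ (norm_fst_snd_le (w : Triple N p m)))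
  refine ⟨((i1.add i2).add i3).add i4, ?_⟩
  have h := integral_add ((i1.add i2).add i3) i4
  have h' := integral_add (i1.add i2) i3
  have h'' := integral_add i1 i2
  simp only [Pi.add_apply] at h h' h''
  rw [h', h''] at h
  exact h.trans_le (by gcongr)

theorem representation_valGrad (hm : 1 < m) (hp : 1 < p) (hpN : p < N) :
    Representation (volume.restrict (Ω : Set (Euc N))) (sobolevModular p (N * p / (N - p)) m)
      (valGrad (p := p) (m := m) (Ω := Ω)) := by
  obtain ⟨K, hK, h⟩ := exists_integral_sobolevModular_le (m := m) (Ω := Ω) hm hp hpN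
  have hpN' : 0 < (N : ℝ) - p := by linarith
  have hP : 0 < N * p / (N - p) := div_pos (mul_pos (by linarith) (by linarith)) hpN'
  have hΩ : ∀ w : sobolevZero p m Ω,
      ∫ x in Ω, sobolevModular p (N * p / (N - p)) m (valGrad w x)
        ≤ ‖w‖ ^ p + (K * ‖w‖) ^ (N * p / (N - p)) + ‖w‖ ^ m + ‖w‖ ^ p := fun w =>
    (setIntegral_le_integral (h w).1 (by
      filter_upwards with x using sobolevModular_nonneg _ _ _ _)).trans (h w).2
  refine ⟨fun z => ?_, fun z w => ?_, fun t z => ?_, fun z => (h z).1.integrableOn, fun R => ?_, ?_⟩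
  · exact ((Lp.aestronglyMeasurable (z : Triple N p m).fst.fst).prodMk
      (Lp.aestronglyMeasurable (z : Triple N p m).fst.snd)).restrict
  · refine ae_restrict_of_ae ?_
    filter_upwards [Lp.coeFn_add (z : Triple N p m).fst.fst (w : Triple N p m).fst.fst,
      Lp.coeFn_add (z : Triple N p m).fst.snd (w : Triple N p m).fst.snd] with x h1 h2
    exact Prod.ext h1 h2
  · refine ae_restrict_of_ae ?_
    filter_upwards [Lp.coeFn_smul t (z : Triple N p m).fst.fst,
      Lp.coeFn_smul t (z : Triple N p m).fst.snd] with x h1 h2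
    exact Prod.ext h1 h2
  · refine ⟨|R| ^ p + (K * |R|) ^ (N * p / (N - p)) + |R| ^ m + |R| ^ p, by positivity,
      fun z hz => (hΩ z).trans ?_⟩
    have hz' : ‖z‖ ≤ |R| := hz.trans (le_abs_self R)
    gcongr
  · refine squeeze_zero (fun z => integral_nonneg fun x => sobolevModular_nonneg _ _ _ _) hΩ ?_
    have hc : Continuous fun t : ℝ =>
        |t| ^ p + (K * |t|) ^ (N * p / (N - p)) + |t| ^ m + |t| ^ p :=
      (((continuous_abs.rpow_const fun _ => Or.inr (by linarith)).add
        ((continuous_abs.const_mul K).rpow_const fun _ => Or.inr hP.le)).add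
        (continuous_abs.rpow_const fun _ => Or.inr (by linarith))).add
        (continuous_abs.rpow_const fun _ => Or.inr (by linarith))
    have h0 := hc.tendsto 0
    rw [abs_zero, mul_zero, Real.zero_rpow (by linarith), Real.zero_rpow hP.ne',
      Real.zero_rpow (by linarith), add_zero, add_zero, add_zero] at h0
    have h1 := h0.comp (tendsto_norm_zero (E := sobolevZero p m Ω))
    simpa only [Function.comp_def, abs_norm] using h1

theorem setIntegral_univ_valGrad {F : ℝ × Euc N → ℝ} (hF : F 0 = 0) (w : sobolevZero p m Ω) :
    ∫ x in univ, F (valGrad w x) = ∫ x in Ω, F (valGrad w x) := by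
  rw [setIntegral_univ]
  refine (setIntegral_eq_integral_of_ae_compl_eq_zero ?_).symm
  filter_upwards [val_grad_ae_eq_zero w] with x hx hxΩ
  obtain ⟨h1, h2⟩ := hx hxΩ
  rw [valGrad, h1, h2]
  exact hF

end SobolevSpace

section Potential

variable {N : ℕ} {p m : ℝ} {Ω : TopologicalSpace.Opens (Euc N)} {V : Euc N → ℝ} {Vinf : ℝ}

theorem weight_const {α : Type*} [MeasurableSpace α] (μ : Measure α) (c : ℝ) :
    Weight μ (fun _ => c) :=
  ⟨aestronglyMeasurable_const, |c|, abs_nonneg c, Eventually.of_forall fun _ => le_rfl⟩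

theorem AssumptionsV.weight (hV : AssumptionsV (Ω : Set (Euc N)) V Vinf) :
    Weight (volume.restrict (Ω : Set (Euc N))) V := by
  obtain ⟨V₀, hV₀, hpos⟩ := hV.pos
  obtain ⟨B, hB⟩ := hV.bounded
  refine ⟨hV.continuousOn.aestronglyMeasurable Ω.isOpen.measurableSet, |B|, abs_nonneg _, ?_⟩
  filter_upwards [ae_restrict_mem Ω.isOpen.measurableSet] with x hx
  rw [abs_of_pos (hV₀.trans_le (hpos x hx))]
  exact (hB x hx).trans (le_abs_self B)

theorem AssumptionsV.weight_sub (hV : AssumptionsV (Ω : Set (Euc N)) V Vinf) :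
    Weight (volume.restrict (Ω : Set (Euc N))) (fun x => Vinf - V x) := by
  obtain ⟨κ, hκ, h⟩ := hV.weight.bounded
  refine ⟨aestronglyMeasurable_const.sub hV.weight.aesm, |Vinf| + κ, by positivity, ?_⟩
  filter_upwards [h] with x hx
  exact (abs_sub _ _).trans (by gcongr)

/-- A weight vanishing at infinity makes the power nonlinearity compact along bounded sequences
which tend to zero almost everywhere. -/
theorem tendsto_pairing_formPower_zero {X : Type*} [NormedAddCommGroup X] [NormedSpace ℝ X]
    {μ : Measure (Euc N)} [IsFiniteMeasureOnCompacts μ] {rep : X → Euc N → ℝ × Euc N} {P : ℝ}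
    {c : Euc N → ℝ} (hp : 1 < p) (hpP : p < P)
    (hR : Representation μ (sobolevModular p P m) rep)
    (hc : Weight μ c)
    (hlim : Tendsto c (Bornology.cobounded (Euc N)) (𝓝 0))
    {a : ℕ → X} {R : ℝ} (ha : ∀ n, ‖a n‖ ≤ R)
    (hae : ∀ᵐ x ∂μ, Tendsto (fun n => rep (a n) x) atTop (𝓝 0)) :
    Tendsto (fun n => pairing hR hc (admissible_formPower hp hpP.le) (a n)) atTop (𝓝 0) := by
  obtain ⟨κ, hκ, hcκ⟩ := hc.bounded
  obtain ⟨K, hK, hball⟩ := hR.bounded R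
  have hΦ := sobolevModular_nonneg (E := Euc N) p P m
  have hmeas : ∀ n, AEStronglyMeasurable (fun x => c x * |(rep (a n) x).1| ^ p)
      μ := fun n =>
    hc.aesm.mul ((continuous_fst.abs.rpow_const fun _ => Or.inr
      (by linarith)).comp_aestronglyMeasurable (hR.aesm (a n)))
  refine tendsto_dual_zero_of_pointwise hR (f := fun n x => c x * |(rep (a n) x).1| ^ p)
    (fun n v => pairing_apply hR hc (admissible_formPower hp hpP.le) (a n) v) (fun n => ?_) ?_
    (fun δ hδ => ?_)
  · refine Integrable.mono' ((hR.integrable (a n)).const_mul κ) (hmeas n) ?_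
    filter_upwards [hcκ] with x hx
    rw [norm_mul, Real.norm_eq_abs, Real.norm_of_nonneg (by positivity)]
    gcongr
    exact abs_fst_rpow_le_sobolevModular (by linarith) le_rfl hpP.le _
  · refine tendsto_integral_abs_of_le_add
      (g := fun n x => sobolevModular p P m (rep (a n) x)) (K := K) hmeas ?_
      (fun n => hR.integrable _) (fun n => ?_) (fun n => hball _ (ha n)) (fun ε hε => ?_)
    · filter_upwards [hae] with x hx
      have h1 : Tendsto (fun n => |(rep (a n) x).1| ^ p) atTop (𝓝 (|(0 : ℝ × Euc N).1| ^ p)) :=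
        ((continuous_fst.abs.rpow_const fun _ => Or.inr (by linarith)).tendsto 0).comp hx
      simpa [Real.zero_rpow (by linarith : p ≠ 0)] using h1.const_mul (c x)
    · filter_upwards with x using hΦ _
    · obtain ⟨A, hA, hy⟩ := rpow_le_mul_rpow_add (α := p) (β := P) (by linarith) hpP
        (ε := ε / (κ + 1)) (by positivity)
      have h1 : ∀ᶠ x in Bornology.cobounded (Euc N), |c x| < ε := by
        simpa using hlim.abs.eventually_lt_const (by simpa using hε)
      obtain ⟨r, -, hr⟩ := (Filter.HasBasis.eventually_iff
        (Metric.hasBasis_cobounded_compl_closedBall (0 : Euc N))).1 h1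
      refine ⟨(Metric.closedBall (0 : Euc N) r).indicator fun _ => κ * A, ?_, fun n => ?_⟩
      · exact (IntegrableOn.integrable_indicator (integrableOn_const (by
          exact measure_closedBall_lt_top.ne)) measurableSet_closedBall)
      · filter_upwards [hcκ] with x hx
        rw [abs_mul, abs_of_nonneg (by positivity : 0 ≤ |(rep (a n) x).1| ^ p)]
        by_cases hxr : x ∈ Metric.closedBall (0 : Euc N) r
        · rw [indicator_of_mem hxr]
          have h2 := hy _ (abs_nonneg (rep (a n) x).1)
          have h3 := abs_fst_rpow_le_sobolevModular (m := m) (P := P) (by linarith) hpP.le le_rfl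
            (rep (a n) x)
          have h4 : κ * (ε / (κ + 1)) ≤ ε := by
            rw [← mul_div_assoc, div_le_iff₀ (by positivity)]
            nlinarith
          calc _ ≤ κ * (ε / (κ + 1) * |(rep (a n) x).1| ^ P + A) := by gcongr
            _ = κ * (ε / (κ + 1)) * |(rep (a n) x).1| ^ P + κ * A := by ring
            _ ≤ _ := by gcongr
        · rw [indicator_of_notMem hxr, add_zero]
          gcongr
          · exact (hr hxr).le
          · exact abs_fst_rpow_le_sobolevModular (by linarith) le_rfl hpP.le _
  · obtain ⟨A, hA, hb⟩ := abs_formPower_le (N := N) (m := m) hp hpP.le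
      (δ := δ / (κ + 1)) (by positivity)
    refine ⟨A, hA, fun n v => ?_⟩
    filter_upwards [hcκ] with x hx
    rw [abs_mul, abs_mul, abs_of_nonneg (by positivity : 0 ≤ |(rep (a n) x).1| ^ p)]
    have h4 : |c x| * (δ / (κ + 1)) ≤ δ := by
      rw [← mul_div_assoc, div_le_iff₀ (by positivity)]
      nlinarith
    calc _ ≤ |c x| * (A * |(rep (a n) x).1| ^ p
          + δ / (κ + 1) * sobolevModular p P m (rep v x)) := by gcongr; exact hb _ _
      _ = A * (|c x| * |(rep (a n) x).1| ^ p)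
          + |c x| * (δ / (κ + 1)) * sobolevModular p P m (rep v x) := by ring
      _ ≤ _ := by
        gcongr
        exact hΦ _

end Potential

theorem mul_conjExponent_lt {N : ℕ} {p m P : ℝ} (hp : 1 < p) (hpN : p < N) (h : m < p - 1 + p / N)
    (hP : P = N * p / (N - p)) : m * P.conjExponent < p := by
  have hpN' : 0 < (N : ℝ) - p := by linarith
  have hN : (0 : ℝ) < N := by linarith
  have h1 : P.conjExponent = N * p / (N * p - (N - p)) := by
    rw [Real.conjExponent, hP, div_sub_one hpN'.ne', div_div_div_cancel_right₀ hpN'.ne']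
  have h2 : 0 < (N : ℝ) * p - (N - p) := by nlinarith
  have h3 : m * N < (p - 1 + p / N) * N := by gcongr
  have h4 : (p - 1 + p / N) * N = N * p - (N - p) := by field_simp; ring
  rw [h4] at h3
  rw [h1, ← mul_div_assoc, div_lt_iff₀ h2]
  nlinarith

section Functionals

variable {N : ℕ} {p m σ ν C P : ℝ} [Fact (1 ≤ ENNReal.ofReal p)] [Fact (1 ≤ ENNReal.ofReal m)]
  {Ω : TopologicalSpace.Opens (Euc N)} {L : Euc N → ℝ} {M : ℝ → Euc N → ℝ} {G : ℝ → ℝ}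

theorem jPairing_eq_pairing
    (hR : Representation (volume.restrict (Ω : Set (Euc N))) (sobolevModular p P m)
      (valGrad (p := p) (m := m) (Ω := Ω)))
    (hL : AssumptionsL p ν C L) (hM : AssumptionsM m ν C M) (hG : AssumptionsG σ C G)
    (hX : Admissible (sobolevModular p P m) (formXi L M))
    (hS : Admissible (sobolevModular p P m) (formS M G)) (w v : sobolevZero p m Ω) :
    jPairing L M G Ω (w : Triple N p m) v
      = pairing hR (weight_const _ 1) (hX.add hS) w v := by
  have i1 := hX.integrable (weight_const _ 1) (hR.aesm w) (hR.integrable w) (hR.aesm v)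
    (hR.integrable v)
  have i2 := hS.integrable (weight_const _ 1) (hR.aesm w) (hR.integrable w) (hR.aesm v)
    (hR.integrable v)
  have h := integral_add i1 i2
  simp only [one_mul, formXi_apply (G := G) hL hM, formS_apply (L := L) hM hG] at h
  rw [pairing_apply]
  simp only [one_mul, add_apply, formXi_apply (G := G) hL hM, formS_apply (L := L) hM hG]
  exact h.symm

theorem potentialPairing_eq_pairing
    (hR : Representation (volume.restrict (Ω : Set (Euc N))) (sobolevModular p P m)
      (valGrad (p := p) (m := m) (Ω := Ω))) {V : Euc N → ℝ}
    (hV : Weight (volume.restrict (Ω : Set (Euc N))) V)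
    (hP : Admissible (sobolevModular p P m : ℝ × Euc N → ℝ) (formPower p))
    (w v : sobolevZero p m Ω) :
    potentialPairing Ω V (w : Triple N p m) v = pairing hR hV hP w v := by
  rw [pairing_apply]
  refine integral_congr_ae (Eventually.of_forall fun x => ?_)
  simp only [formPower_apply, valGrad]
  ring

theorem hasFDerivAt_energy (hp : 1 < p) (hm : 1 < m) (hP : 0 < P)
    (hR : Representation (volume.restrict (Ω : Set (Euc N))) (sobolevModular p P m)
      (valGrad (p := p) (m := m) (Ω := Ω)))
    (hL : AssumptionsL p ν C L) (hM : AssumptionsM m ν C M) (hG : AssumptionsG σ C G)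
    (hX : Admissible (sobolevModular p P m) (formXi L M))
    (hS : Admissible (sobolevModular p P m) (formS M G)) {V : Euc N → ℝ}
    (hV : Weight (volume.restrict (Ω : Set (Euc N))) V)
    (hB : Admissible (sobolevModular p P m : ℝ × Euc N → ℝ) (formPower p))
    (w : sobolevZero p m Ω) :
    HasFDerivAt (fun z : sobolevZero p m Ω => energy L M G Ω V (z : Triple N p m))
      (pairing hR (weight_const _ 1) (hX.add hS) w + pairing hR hV hB w) w := by
  have hΦ : Modular (sobolevModular p P m : ℝ × Euc N → ℝ) :=
    modular_sobolevModular (by linarith) hP (by linarith)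
  have h1 := hasFDerivAt_integral hΦ hR (weight_const _ 1) (hX.add hS)
    (e := fun y => j L M G y.1 y.2) (hasFDerivAt_j hL hM hG)
    (j_zero hL hM hG (by linarith) (by linarith)) w
  have h2 := hasFDerivAt_integral hΦ hR hV hB (e := fun y => |y.1| ^ p / p)
    (hasFDerivAt_abs_rpow_fst hp) (by simp [Real.zero_rpow (by linarith : p ≠ 0)]) w
  simp only [one_mul] at h1
  exact h1.add h2

theorem energy_univ_const (hp : p ≠ 0) (hm : m ≠ 0) (hL : AssumptionsL p ν C L)
    (hM : AssumptionsM m ν C M) (hG : AssumptionsG σ C G) (c : ℝ) (z : sobolevZero p m Ω) :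
    energy L M G univ (fun _ => c) (z : Triple N p m)
      = energy L M G Ω (fun _ => c) (z : Triple N p m) := by
  unfold energy
  congr 1
  · exact setIntegral_univ_valGrad (F := fun y => j L M G y.1 y.2) (j_zero hL hM hG hp hm) z
  · exact setIntegral_univ_valGrad (F := fun y => c * (|y.1| ^ p / p))
      (by simp [Real.zero_rpow hp]) z

theorem hasFDerivAt_energy_univ (hp : 1 < p) (hm : 1 < m) (hP : 0 < P)
    (hR : Representation (volume.restrict (Ω : Set (Euc N))) (sobolevModular p P m)
      (valGrad (p := p) (m := m) (Ω := Ω)))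
    (hL : AssumptionsL p ν C L) (hM : AssumptionsM m ν C M) (hG : AssumptionsG σ C G)
    (hX : Admissible (sobolevModular p P m) (formXi L M))
    (hS : Admissible (sobolevModular p P m) (formS M G)) (c : ℝ)
    (hB : Admissible (sobolevModular p P m : ℝ × Euc N → ℝ) (formPower p))
    (w : sobolevZero p m Ω) :
    HasFDerivAt (fun z : sobolevZero p m Ω => energy L M G univ (fun _ => c) (z : Triple N p m))
      (pairing hR (weight_const _ 1) (hX.add hS) w + pairing hR (weight_const _ c) hB w) w :=
  (hasFDerivAt_energy hp hm hP hR hL hM hG hX hS (weight_const _ c) hB w).congr_of_eventuallyEq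
    (Eventually.of_forall fun z =>
      energy_univ_const (by linarith) (by linarith) hL hM hG c z)

/-- A weakly convergent sequence in a normed space is bounded. -/
theorem exists_norm_le_of_tendsto_weak {X : Type*} [NormedAddCommGroup X] [NormedSpace ℝ X]
    {u : ℕ → X} {u₀ : X}
    (h : ∀ f : X →L[ℝ] ℝ, Tendsto (fun n => f (u n)) atTop (𝓝 (f u₀))) :
    ∃ R, ∀ n, ‖u n‖ ≤ R := by
  obtain ⟨R, hR⟩ := banach_steinhaus (g := fun n => NormedSpace.inclusionInDoubleDual ℝ X (u n))
    fun f => by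
      obtain ⟨K, hK⟩ := (h f).norm.bddAbove_range
      exact ⟨K, fun n => hK (mem_range_self n)⟩
  refine ⟨R, fun n => ?_⟩
  rw [← (NormedSpace.inclusionInDoubleDualLi ℝ (E := X)).norm_map (u n)]
  exact hR n

end Functionals

end

end QuasilinearSplitting

open QuasilinearSplitting in
theorem theorem3p5 (N : ℕ) (p m σ : ℝ)
    [Fact (1 ≤ ENNReal.ofReal p)] [Fact (1 ≤ ENNReal.ofReal m)]
    (hm : 1 < m) (hmp : m < p) (hpN : p < N)
    (hm_lower : p - 1 ≤ m) (hm_upper : m < p - 1 + p / N)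
    (hpσ : p < σ) (hσ : σ < N * p / (N - p))
    (hsub : p ≤ 2 ∨ m ≤ 2 ∨ σ ≤ 2)
    (Ω : TopologicalSpace.Opens (Euc N)) (hΩ : Bornology.IsBounded ((Ω : Set (Euc N))ᶜ))
    (V : Euc N → ℝ) (Vinf : ℝ) (hV : AssumptionsV (Ω : Set (Euc N)) V Vinf)
    (ν C : ℝ) (hν : 0 < ν)
    (L : Euc N → ℝ) (hL : AssumptionsL p ν C L)
    (M : ℝ → Euc N → ℝ) (hM : AssumptionsM m ν C M)
    (G : ℝ → ℝ) (hG : AssumptionsG σ C G)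
    (u : ℕ → sobolevZero p m Ω) (u₀ : sobolevZero p m Ω)
    (hweak : ∀ f : sobolevZero p m Ω →L[ℝ] ℝ, Tendsto (fun n => f (u n)) atTop (𝓝 (f u₀)))
    (hae : ∀ᵐ x ∂(volume.restrict (Ω : Set (Euc N))),
      Tendsto (fun n => val (u n : Triple N p m) x) atTop (𝓝 (val (u₀ : Triple N p m) x)))
    (hgrad : ∀ᵐ x ∂(volume.restrict (Ω : Set (Euc N))),
      Tendsto (fun n => grad (u n : Triple N p m) x) atTop (𝓝 (grad (u₀ : Triple N p m) x)))
    (w : ℕ → (sobolevZero p m Ω →L[ℝ] ℝ)) (hw : Tendsto w atTop (𝓝 0))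
    (hPS : ∀ n, ∀ v : sobolevZero p m Ω,
      jPairing L M G Ω (u n : Triple N p m) v + potentialPairing Ω V (u n : Triple N p m) v
        = w n v) :
    HasFDerivAt (fun z : sobolevZero p m Ω => energy L M G Ω V (z : Triple N p m))
      (0 : sobolevZero p m Ω →L[ℝ] ℝ) u₀ ∧
    (∃ ξ : ℕ → (sobolevZero p m Ω →L[ℝ] ℝ), Tendsto ξ atTop (𝓝 0) ∧
      ∀ n, ∀ v : sobolevZero p m Ω,
        ξ n v = jPairing L M G Ω ((u n - u₀ : sobolevZero p m Ω) : Triple N p m) v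
          - jPairing L M G Ω (u n : Triple N p m) v
          + jPairing L M G Ω (u₀ : Triple N p m) v) ∧
    (∃ ζ : ℕ → (sobolevZero p m Ω →L[ℝ] ℝ), Tendsto ζ atTop (𝓝 0) ∧
      (∀ n, ∀ v : sobolevZero p m Ω,
        jPairing L M G Ω ((u n - u₀ : sobolevZero p m Ω) : Triple N p m) v
          + potentialPairing Ω (fun _ => Vinf)
              ((u n - u₀ : sobolevZero p m Ω) : Triple N p m) v = ζ n v) ∧
      ∀ n, HasFDerivAt
        (fun z : sobolevZero p m Ω => energy L M G univ (fun _ => Vinf) (z : Triple N p m))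
        (ζ n) (u n - u₀)) := by
  have hp : 1 < p := hm.trans hmp
  have hpN' : 0 < (N : ℝ) - p := by linarith
  have hp0 : 0 < p := zero_lt_one.trans hp
  have hpP : p < N * p / (N - p) := hpσ.trans hσ
  have hP0 : 0 < N * p / (N - p) := hp0.trans hpP
  have hΦ : Modular (sobolevModular p (N * p / (N - p)) m : ℝ × Euc N → ℝ) :=
    modular_sobolevModular hp0 hP0 (zero_lt_one.trans hm)
  have hR := representation_valGrad (m := m) (Ω := Ω) hm hp hpN
  have hX := admissible_formXi (P := N * p / (N - p)) hL hM hm hmp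
  have hS := admissible_formS hM hG hm hmp hpσ hσ (mul_conjExponent_lt hp hpN hm_upper rfl)
  have hB := admissible_formPower (N := N) (m := m) hp hpP.le
  have h1 := weight_const (volume.restrict (Ω : Set (Euc N))) 1
  have hc := weight_const (volume.restrict (Ω : Set (Euc N))) Vinf
  have hbdd := (exists_norm_le_of_tendsto_weak hweak).choose_spec
  have hlim : ∀ᵐ x ∂(volume.restrict (Ω : Set (Euc N))),
      Tendsto (fun n => valGrad (u n) x) atTop (𝓝 (valGrad u₀ x)) := by
    filter_upwards [hae, hgrad] with x hx hx' using hx.prodMk_nhds hx'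
  have eJ := jPairing_eq_pairing hR hL hM hG hX hS
  have eV := potentialPairing_eq_pairing hR hV.weight hB
  have eVinf := potentialPairing_eq_pairing hR hc hB
  have hPS' : ∀ n, pairing hR h1 (hX.add hS) (u n) + pairing hR hV.weight hB (u n) = w n :=
    fun n => ContinuousLinearMap.ext fun v =>
      (congrArg₂ (· + ·) (eJ (u n) v) (eV (u n) v)).symm.trans (hPS n v)
  refine ⟨?_, ⟨_, tendsto_pairing_splitting hΦ hR h1 (hX.add hS) hbdd hlim, fun n v => ?_⟩,
    ⟨_, tendsto_pairing_add_pairing_sub hΦ hR h1 (hX.add hS) hV.weight hB hc hV.weight_sub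
      (fun x => by ring) hbdd hlim hw hPS' (tendsto_pairing_formPower_zero hp hpP hR hV.weight_sub
        (by simpa using hV.tendsto.const_sub Vinf) (norm_sub_le_add hbdd) (hR.tendsto_sub_zero hlim)),
      fun n v => ?_, fun n => ?_⟩⟩
  · exact (hasFDerivAt_energy hp hm hP0 hR hL hM hG hX hS hV.weight hB u₀).congr_fderiv
      (pairing_add_pairing_eq_zero hΦ hR h1 (hX.add hS) hV.weight hB hbdd hlim hw hPS')
  · exact (congrArg₂ (· + ·) (congrArg₂ (· - ·) (eJ (u n - u₀) v) (eJ (u n) v)) (eJ u₀ v)).symm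
  · exact congrArg₂ (· + ·) (eJ (u n - u₀) v) (eVinf (u n - u₀) v)
  · exact hasFDerivAt_energy_univ hp hm hP0 hR hL hM hG hX hS Vinf hB (u n - u₀)
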